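/- A \emph{box} is given by its integer dimensions $(a,b,c)$ with $1\le a\le b\le c$; for a positive integer $s$ let $P(s)$ be the set of all such triples with $2(ab+ac+bc)=s$ (the boxes of surface area $s$ up to isomorphism). A \emph{polyomino} is a finite nonempty edge-connected set of unit cells of the square grid; we take it to be without holes, i.e. the complementary set of cells is also edge-connected. A polyomino $N$ \emph{folds into} the box $(a,b,c)$ if its cells can be mapped isometrically and bijectively onto the unit squares that tile the surface of $[0,a]\times[0,b]\times[0,c]$ in such a way that, for any two edge-adjacent cells of $N$, the two images of their common edge agree pointwise. A set of boxes has a \emph{common unfolding} if a single polyomino folds into each of them. For a positive integer $k$ let $\Delta(k)$ be the smallest positive integer $s$ such that some $P'\subseteq P(s)$ with $|P'|=k$ has no common unfolding ($\Delta(k)=\infty$ if there is no such $s$). Then for every $s\le 86$, any two distinct boxes in $P(s)$ have a common unfolding. Consequently $\Delta(2)>86$. -/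

import Mathlib

/-! ## Polyominoes -/

/-- The square grid: its vertices are the unit cells of the plane (the cell `(x, y)` is
`[x, x + 1] × [y, y + 1]`), and two cells are adjacent when they share an edge. -/
def cellGraph : SimpleGraph (ℤ × ℤ) where
  Adj p q := |p.1 - q.1| + |p.2 - q.2| = 1
  symm := ⟨fun p q h => by rwa [abs_sub_comm q.1, abs_sub_comm q.2]⟩
  loopless := ⟨fun p h => by simp at h⟩

/-- A simply connected polyomino: a finite nonempty set of cells that is edge-connected and has
no holes, i.e. the complementary set of cells is edge-connected as well. -/
structure IsPolyomino (P : Finset (ℤ × ℤ)) : Prop where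
  connected : (cellGraph.induce (P : Set (ℤ × ℤ))).Connected
  noHoles : (cellGraph.induce ((P : Set (ℤ × ℤ))ᶜ)).Connected

/-! ## Boxes -/

/-- `boxDims s` is the set `P(s)` of all triples of positive integers `a ≤ b ≤ c` with
`2(ab + ac + bc) = s`: the dimensions, up to isomorphism, of the integer boxes of surface
area `s`. -/
def boxDims (s : ℕ) : Set (ℕ × ℕ × ℕ) :=
  {B | 0 < B.1 ∧ B.1 ≤ B.2.1 ∧ B.2.1 ≤ B.2.2 ∧
    2 * (B.1 * B.2.1 + B.1 * B.2.2 + B.2.1 * B.2.2) = s}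

/-- The vertex set of the parallelogram with corner `o` and sides `u`, `v`. -/
def quad (o u v : ℤ × ℤ × ℤ) : Finset (ℤ × ℤ × ℤ) :=
  {o, o + u, o + v, o + u + v}

/-- The unit squares that tile the surface of the box `[0, a] × [0, b] × [0, c]`, each given by
the set of its four vertices. The three pieces are the two faces orthogonal to each axis. -/
noncomputable def surfaceSquares (B : ℕ × ℕ × ℕ) : Finset (Finset (ℤ × ℤ × ℤ)) :=
  let a : ℤ := B.1
  let b : ℤ := B.2.1
  let c : ℤ := B.2.2
  (({0, a} ×ˢ Finset.Ico 0 b ×ˢ Finset.Ico 0 c).image fun o => quad o (0, 1, 0) (0, 0, 1)) ∪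
  ((Finset.Ico 0 a ×ˢ {0, b} ×ˢ Finset.Ico 0 c).image fun o => quad o (1, 0, 0) (0, 0, 1)) ∪
  ((Finset.Ico 0 a ×ˢ Finset.Ico 0 b ×ˢ {0, c}).image fun o => quad o (1, 0, 0) (0, 1, 0))

/-! ## Folding -/

/-- The dot product on `ℤ³`. -/
def dot (u v : ℤ × ℤ × ℤ) : ℤ := u.1 * v.1 + u.2.1 * v.2.1 + u.2.2 * v.2.2

/-- A folding of the polyomino `P` onto the surface of the box `B` along the edges of its cells.
The cell `p` is carried to space by the isometry
`p + (x, y) ↦ corner p + x • right p + y • up p` (`0 ≤ x, y ≤ 1`). -/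
structure Folding (P : Finset (ℤ × ℤ)) (B : ℕ × ℕ × ℕ) where
  /-- The image of the lower left vertex of a cell. -/
  corner : ℤ × ℤ → ℤ × ℤ × ℤ
  /-- The image of the direction `(1, 0)` in a cell. -/
  right : ℤ × ℤ → ℤ × ℤ × ℤ
  /-- The image of the direction `(0, 1)` in a cell. -/
  up : ℤ × ℤ → ℤ × ℤ × ℤ
  /-- Each cell is carried isometrically. -/
  isometric : ∀ p ∈ P, dot (right p) (right p) = 1 ∧ dot (up p) (up p) = 1 ∧
    dot (right p) (up p) = 0
  /-- The edge shared by a cell and the cell to its right is not torn: both of its endpoints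
  have the same image, whether seen from the one cell or from the other. -/
  glue_right : ∀ p ∈ P, p + (1, 0) ∈ P →
    corner p + right p = corner (p + (1, 0)) ∧
    corner p + right p + up p = corner (p + (1, 0)) + up (p + (1, 0))
  /-- The edge shared by a cell and the cell above it is not torn. -/
  glue_up : ∀ p ∈ P, p + (0, 1) ∈ P →
    corner p + up p = corner (p + (0, 1)) ∧
    corner p + right p + up p = corner (p + (0, 1)) + right (p + (0, 1))
  /-- The cells of `P` are carried bijectively onto the unit squares of the surface of `B`. -/
  bijOn : Set.BijOn (fun p => quad (corner p) (right p) (up p)) (P : Set (ℤ × ℤ))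
    (surfaceSquares B : Set (Finset (ℤ × ℤ × ℤ)))

/-- The boxes in `S` have a common unfolding: one simply connected polyomino folds into each
of them. -/
def HasCommonUnfolding (S : Set (ℕ × ℕ × ℕ)) : Prop :=
  ∃ P : Finset (ℤ × ℤ), IsPolyomino P ∧ ∀ B ∈ S, Nonempty (Folding P B)

/-- `Δ(k)`: the smallest `s` such that some `k` boxes of surface area `s` have no common
unfolding; it is `⊤` when there is no such `s`. -/
noncomputable def unfoldingDelta (k : ℕ) : ℕ∞ :=
  ⨅ s ∈ {s : ℕ | 0 < s ∧ ∃ S ⊆ boxDims s, S.encard = k ∧ ¬ HasCommonUnfolding S}, (s : ℕ∞)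

/-! The theorem is a finite check. If `2(ab + ac + bc) ≤ 86` with `1 ≤ a ≤ b ≤ c`, then `a ≤ 3`, `b
≤ 5` and `c ≤ 21`, and among these boxes there are exactly 46 unordered pairs of distinct boxes of
equal area. For each pair an explicit net is written down, and the kernel evaluates a Boolean
checker on it. The mathematics lies in the soundness of that checker.

A certificate lists, for each cell, its index in a 32 × 32 grid and two numbers saying how the cell
is placed on the first and on the second box. A placement `n` is read in mixed radix: `n % 8` is one
of the eight symmetries of a square, `n / 8 % 3` the axis orthogonal to the square, and `n / 24` the
least vertex `x + 6y + 36z`. Base 6 suffices for `x` and `y`, even on the far faces, because `a, b ≤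
5`.

Both connectedness conditions are verified by flood fill on bit masks (`of_testBit_flood`). The net
avoids the border of the grid, so the infinite complement reduces to the grid: every cell on the
border or outside is joined to the origin along full rows and columns (`joined_compl_gridCells`).

For the folding, each pair of adjacent cells is tested for agreement on the common edge. Distinct
values of `n / 8` give distinct squares (`tileKey_eq`), so the map is injective into the surface;
the number of cells equals the surface area, which bounds the number of surface squares
(`card_surfaceSquares_le`), so the map is also onto.

The bound on `Δ(2)` follows at once: a two-element set without a common unfolding forces area at
least 87. -/

/-! ## Lists of indices as bit masks -/

/-- The number whose binary digits equal to `1` are those with index in `l`. -/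
def bitmask (l : List ℕ) : ℕ := l.foldl (fun m i => m ||| 1 <<< i) 0

theorem testBit_one_shiftLeft (i j : ℕ) : (1 <<< i).testBit j = decide (i = j) := by
  rw [Nat.one_shiftLeft, Nat.testBit_two_pow]

theorem testBit_bitmask {l : List ℕ} {i : ℕ} : (bitmask l).testBit i = true ↔ i ∈ l := by
  -- The fold has to be generalised to an arbitrary accumulator for the induction.
  suffices h : ∀ m : ℕ, (l.foldl (fun m i => m ||| 1 <<< i) m).testBit i = true ↔
      m.testBit i = true ∨ i ∈ l by
    simpa [bitmask] using h 0
  induction l with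
  | nil => simp
  | cons k l ih =>
    intro m
    rw [List.foldl_cons, ih, Nat.testBit_or, testBit_one_shiftLeft]
    simp only [Bool.or_eq_true, decide_eq_true_eq, List.mem_cons, or_assoc, @eq_comm _ i k]

/-- The members of the list are distinct and none of them is the index of a digit `1` of `m`. -/
def nodupFrom : ℕ → List ℕ → Bool
  | _, [] => true
  | m, k :: l => !m.testBit k && nodupFrom (m ||| 1 <<< k) l

/-- The mask `m` plays the role of the set of members already seen. The second conjunct carries the
induction: the tail avoids the bit just set, hence does not contain the head. -/
theorem nodup_of_nodupFrom {l : List ℕ} {m : ℕ} (h : nodupFrom m l = true) :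
    l.Nodup ∧ ∀ k ∈ l, m.testBit k = false := by
  induction l generalizing m with
  | nil => simp
  | cons k l ih =>
    simp only [nodupFrom, Bool.and_eq_true, Bool.not_eq_true'] at h
    obtain ⟨hl, hm⟩ := ih h.2
    simp only [Nat.testBit_or, testBit_one_shiftLeft, Bool.or_eq_false_iff,
      decide_eq_false_iff_not] at hm
    refine ⟨List.nodup_cons.2 ⟨fun hk => (hm k hk).2 rfl, hl⟩, ?_⟩
    intro j hj
    rcases List.mem_cons.1 hj with rfl | hj
    · exact h.1
    · exact (hm j hj).1

/-- `n` rounds of flooding inside `mask`, from the set of indices `m`, where `i` is a neighbour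
of `i ± 1` and of `i ± 32`. The case distinction makes the kernel evaluate each round once. -/
def flood (mask : ℕ) : ℕ → ℕ → ℕ
  | 0, m => m
  | n + 1, m =>
    Nat.casesOn ((m ||| m <<< 1 ||| m >>> 1 ||| m <<< 32 ||| m >>> 32) &&& mask)
      (flood mask n 0) fun k => flood mask n (k + 1)

/-- Both branches of the case distinction continue with the same number, so it can be forgotten in
proofs. -/
theorem flood_succ (mask n m : ℕ) : flood mask (n + 1) m =
    flood mask n ((m ||| m <<< 1 ||| m >>> 1 ||| m <<< 32 ||| m >>> 32) &&& mask) := by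
  rw [flood]
  cases (m ||| m <<< 1 ||| m >>> 1 ||| m <<< 32 ||| m >>> 32) &&& mask <;> rfl

/-- Flooding preserves any property that passes from an index to its neighbours inside the mask.
Only this soundness is needed: with too few rounds the later equality tests could fail, but never
succeed wrongly. The neighbour relation here is on indices and includes the spurious step from the
end of one row to the start of the next, which the applications must deal with. -/
theorem of_testBit_flood {mask : ℕ} {Q : ℕ → Prop}
    (hQ : ∀ i j, Q i → mask.testBit j = true →
      j = i + 1 ∨ i = j + 1 ∨ j = i + 32 ∨ i = j + 32 → Q j) {n m : ℕ}
    (hm : ∀ i, m.testBit i = true → Q i) {i : ℕ} (hi : (flood mask n m).testBit i = true) :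
    Q i := by
  induction n generalizing m with
  | zero => exact hm i hi
  | succ n ih =>
    rw [flood_succ] at hi
    refine ih (fun j hj => ?_) hi
    simp only [Nat.testBit_and, Nat.testBit_or, Nat.testBit_shiftLeft, Nat.testBit_shiftRight,
      Bool.and_eq_true, Bool.or_eq_true, decide_eq_true_eq] at hj
    obtain ⟨(((hj | hj) | hj) | hj) | hj, hmask⟩ := hj
    · exact hm j hj
    · exact hQ _ j (hm _ hj.2) hmask (by omega)
    · exact hQ _ j (hm _ hj) hmask (by omega)
    · exact hQ _ j (hm _ hj.2) hmask (by omega)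
    · exact hQ _ j (hm _ hj) hmask (by omega)

/-! ## Connectedness in the square grid -/

theorem cellGraph_adj_right (p : ℤ × ℤ) : cellGraph.Adj p (p + (1, 0)) := by
  simp [cellGraph]

theorem cellGraph_adj_up (p : ℤ × ℤ) : cellGraph.Adj p (p + (0, 1)) := by
  simp [cellGraph]

/-- Two cells of `S` are joined by a path of cells of `S`. -/
def CellsJoined (S : Set (ℤ × ℤ)) (p q : ℤ × ℤ) : Prop :=
  ∃ (hp : p ∈ S) (hq : q ∈ S), (cellGraph.induce S).Reachable ⟨p, hp⟩ ⟨q, hq⟩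

namespace CellsJoined

variable {S : Set (ℤ × ℤ)} {p q r : ℤ × ℤ}

theorem refl (hp : p ∈ S) : CellsJoined S p p := ⟨hp, hp, .refl _⟩

theorem trans : CellsJoined S p q → CellsJoined S q r → CellsJoined S p r :=
  fun ⟨hp, _, h⟩ ⟨_, hr, h'⟩ => ⟨hp, hr, h.trans h'⟩

theorem of_adj (hp : p ∈ S) (hq : q ∈ S) (h : cellGraph.Adj p q) : CellsJoined S p q :=
  ⟨hp, hq, SimpleGraph.Adj.reachable (by simpa using h)⟩

theorem connected (hp : p ∈ S) (h : ∀ q ∈ S, CellsJoined S p q) : (cellGraph.induce S).Connected := by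
  rw [SimpleGraph.connected_iff_exists_forall_reachable]
  exact ⟨⟨p, hp⟩, fun q => (h q q.2).2.2⟩

/-- Integer induction walks the line in both directions from `p`. Full rows and columns obtained
this way connect the unbounded part of the complement of a net. -/
theorem of_line (d : ℤ × ℤ) (hd : ∀ p, cellGraph.Adj p (p + d)) (h : ∀ k : ℤ, p + k • d ∈ S)
    (k : ℤ) : CellsJoined S p (p + k • d) := by
  induction k with
  | zero => simpa using refl (by simpa using h 0)
  | succ k ih =>
    refine ih.trans (of_adj (h _) (h _) ?_)
    have := hd (p + (k : ℤ) • d)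
    rwa [add_assoc, ← add_one_zsmul] at this
  | pred k ih =>
    refine ih.trans (of_adj (h _) (h _) ?_)
    have := hd (p + (-(k : ℤ) - 1) • d)
    rw [add_assoc, ← add_one_zsmul, sub_add_cancel] at this
    exact this.symm

theorem of_row (y : ℤ) (h : ∀ x, (x, y) ∈ S) (x x' : ℤ) : CellsJoined S (x, y) (x', y) := by
  have := of_line (S := S) (p := (x, y)) (1, 0) cellGraph_adj_right
    (fun k => by simpa using h _) (x' - x)
  simpa using this

theorem of_column (x : ℤ) (h : ∀ y, (x, y) ∈ S) (y y' : ℤ) : CellsJoined S (x, y) (x, y') := by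
  have := of_line (S := S) (p := (x, y)) (0, 1) cellGraph_adj_up
    (fun k => by simpa using h _) (y' - y)
  simpa using this

end CellsJoined

/-! ## Polyominoes in a square of side 32 -/

/-- The `i`-th cell of the square `[0, 32] × [0, 32]`, row by row. -/
def gridCell (i : ℕ) : ℤ × ℤ := ((i % 32 : ℕ), (i / 32 : ℕ))

theorem gridCell_injective : Function.Injective gridCell := by
  intro i j h
  simp only [gridCell, Prod.mk.injEq, Nat.cast_inj] at h
  omega

/-- True adjacency always shows in the indices, with no side condition; only the converse,
`gridCell_add_one`, fails at the end of a row. -/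
theorem gridCell_eq_add_right {i j : ℕ} (h : gridCell j = gridCell i + (1, 0)) : j = i + 1 := by
  simp only [gridCell, Prod.mk_add_mk, Prod.mk.injEq] at h
  omega

theorem gridCell_eq_add_up {i j : ℕ} (h : gridCell j = gridCell i + (0, 1)) : j = i + 32 := by
  simp only [gridCell, Prod.mk_add_mk, Prod.mk.injEq] at h
  omega

theorem gridCell_add_one {i : ℕ} (h : i % 32 ≠ 31) : gridCell (i + 1) = gridCell i + (1, 0) := by
  simp only [gridCell, Prod.mk_add_mk, Prod.mk.injEq]
  omega

theorem gridCell_add_side (i : ℕ) : gridCell (i + 32) = gridCell i + (0, 1) := by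
  simp only [gridCell, Prod.mk_add_mk, Prod.mk.injEq]
  omega

/-- The set of the cells with the given indices. -/
def gridCells (l : List ℕ) : Finset (ℤ × ℤ) := (l.map gridCell).toFinset

theorem mem_gridCells {l : List ℕ} {p : ℤ × ℤ} : p ∈ gridCells l ↔ ∃ i ∈ l, gridCell i = p := by
  simp [gridCells]

theorem gridCell_mem_gridCells {l : List ℕ} {i : ℕ} : gridCell i ∈ gridCells l ↔ i ∈ l := by
  rw [mem_gridCells]
  exact ⟨fun ⟨j, hj, h⟩ => gridCell_injective h ▸ hj, fun h => ⟨i, h, rfl⟩⟩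

/-- The cell with index `i` does not lie on the border of the square. -/
def isInner (i : ℕ) : Bool :=
  Nat.ble 1 (i % 32) && Nat.ble (i % 32) 30 && Nat.ble 1 (i / 32) && Nat.ble (i / 32) 30

theorem isInner_iff {i : ℕ} :
    isInner i = true ↔ 1 ≤ i % 32 ∧ i % 32 ≤ 30 ∧ 1 ≤ i / 32 ∧ i / 32 ≤ 30 := by
  simp only [isInner, Bool.and_eq_true, Nat.ble_eq, and_assoc]

/-- The bit mask of all indices below `k`. -/
def fullMask (k : ℕ) : ℕ := 2 ^ k - 1

theorem testBit_fullMask (k i : ℕ) : (fullMask k).testBit i = decide (i < k) :=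
  Nat.testBit_two_pow_sub_one k i

/-- All cells with indices in `l` are reached from the first one, and all other cells of the
square are reached from its corner. -/
def isPolyominoCode (l : List ℕ) : Bool :=
  l.all isInner && flood (bitmask l) 128 (1 <<< l.headI) == bitmask l &&
    (flood (fullMask 1024 ^^^ bitmask l) 128 1 ||| bitmask l) == fullMask 1024

/-- The flood invariant is "joined to the first cell". Inner cells avoid columns 0 and 31, so no
step between two of them wraps around a row end. -/
theorem connected_gridCells {l : List ℕ} (hl : l ≠ []) (hin : ∀ i ∈ l, isInner i = true) {n : ℕ}
    (h : flood (bitmask l) n (1 <<< l.headI) = bitmask l) :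
    (cellGraph.induce (gridCells l : Set (ℤ × ℤ))).Connected := by
  have hhead : l.headI ∈ l := by
    cases l with
    | nil => exact absurd rfl hl
    | cons a l => simp
  refine CellsJoined.connected (p := gridCell l.headI) (gridCell_mem_gridCells.2 hhead) ?_
  intro q hq
  obtain ⟨i, hi, rfl⟩ := mem_gridCells.1 hq
  rw [← testBit_bitmask, ← h] at hi
  refine of_testBit_flood (Q := fun i => CellsJoined (gridCells l) (gridCell l.headI) (gridCell i))
    ?_ ?_ hi
  · intro i j hi hj hij
    obtain ⟨_, hi', _⟩ := id hi
    rw [Finset.mem_coe, gridCell_mem_gridCells] at hi'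
    rw [testBit_bitmask] at hj
    have hii := isInner_iff.1 (hin i hi')
    have hjj := isInner_iff.1 (hin j hj)
    refine hi.trans (.of_adj (gridCell_mem_gridCells.2 hi') (gridCell_mem_gridCells.2 hj) ?_)
    rcases hij with rfl | rfl | rfl | rfl
    · rw [gridCell_add_one (by omega)]
      exact cellGraph_adj_right _
    · rw [gridCell_add_one (by omega)]
      exact (cellGraph_adj_right _).symm
    · rw [gridCell_add_side]
      exact cellGraph_adj_up _
    · rw [gridCell_add_side]
      exact (cellGraph_adj_up _).symm
  · intro i hi
    rw [testBit_one_shiftLeft, decide_eq_true_eq] at hi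
    subst hi
    exact .refl (gridCell_mem_gridCells.2 hhead)

theorem notMem_gridCells {l : List ℕ} (hin : ∀ i ∈ l, isInner i = true) {p : ℤ × ℤ}
    (hp : p.1 ≤ 0 ∨ 31 ≤ p.1 ∨ p.2 ≤ 0 ∨ 31 ≤ p.2) : p ∉ gridCells l := by
  intro h
  obtain ⟨i, hi, rfl⟩ := mem_gridCells.1 h
  have := isInner_iff.1 (hin i hi)
  simp only [gridCell] at hp
  omega

/-- An L-shaped path works. Row 0 and column 0 miss the net, and so does the whole column (or row)
through `p` when its abscissa (or ordinate) lies outside `1, …, 30`. -/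
theorem joined_compl_gridCells {l : List ℕ} (hin : ∀ i ∈ l, isInner i = true) {p : ℤ × ℤ}
    (hp : p.1 ≤ 0 ∨ 31 ≤ p.1 ∨ p.2 ≤ 0 ∨ 31 ≤ p.2) :
    CellsJoined (gridCells l : Set (ℤ × ℤ))ᶜ (0, 0) p := by
  have hout : ∀ q : ℤ × ℤ, q.1 ≤ 0 ∨ 31 ≤ q.1 ∨ q.2 ≤ 0 ∨ 31 ≤ q.2 →
      q ∈ (gridCells l : Set (ℤ × ℤ))ᶜ := fun q hq => by
    simpa using notMem_gridCells hin hq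
  obtain ⟨x, y⟩ := p
  by_cases hx : x ≤ 0 ∨ 31 ≤ x
  · exact (CellsJoined.of_row 0 (fun _ => hout _ (by simp)) 0 x).trans
      (CellsJoined.of_column x (fun _ => hout _ (by simp only; omega)) 0 y)
  · simp only at hp
    exact (CellsJoined.of_column 0 (fun _ => hout _ (by simp)) 0 y).trans
      (CellsJoined.of_row y (fun _ => hout _ (by simp only; omega)) 0 x)

/-- Cells on the border or beyond are handled by `joined_compl_gridCells`; the others have an index
below 1024, and the flood from bit 0, the cell `(0, 0)`, reaches all of them outside the net. -/
theorem connected_compl_gridCells {l : List ℕ} (hin : ∀ i ∈ l, isInner i = true) {n : ℕ}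
    (h : flood (fullMask 1024 ^^^ bitmask l) n 1 ||| bitmask l = fullMask 1024) :
    (cellGraph.induce (gridCells l : Set (ℤ × ℤ))ᶜ).Connected := by
  refine CellsJoined.connected (p := (0, 0)) (by simpa using notMem_gridCells hin (by simp)) ?_
  intro q hq
  by_cases hout : q.1 ≤ 0 ∨ 31 ≤ q.1 ∨ q.2 ≤ 0 ∨ 31 ≤ q.2
  · exact joined_compl_gridCells hin hout
  obtain ⟨i, hi, rfl⟩ : ∃ i < 1024, gridCell i = q := by
    refine ⟨q.1.toNat + 32 * q.2.toNat, by omega, ?_⟩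
    ext <;> simp only [gridCell] <;> omega
  have hil : i ∉ l := by simpa [gridCell_mem_gridCells] using hq
  have hbit : (flood (fullMask 1024 ^^^ bitmask l) n 1).testBit i = true := by
    have := congrArg (fun m => m.testBit i) h
    simp only [Nat.testBit_or, testBit_fullMask, hi, decide_true,
      Bool.or_eq_true, testBit_bitmask, hil, or_false] at this
    exact this
  refine of_testBit_flood
    (Q := fun i => CellsJoined (gridCells l : Set (ℤ × ℤ))ᶜ (0, 0) (gridCell i)) ?_ ?_ hbit
  · intro i j hi hj hij
    have hjl : gridCell j ∈ (gridCells l : Set (ℤ × ℤ))ᶜ := by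
      -- The exclusive or is the complement of the net only below 1024; an index from 1024 on would
      -- denote a cell above the grid, which is not in the net either.
      have hj' : j ∉ l ∨ ¬ j < 1024 := by
        by_contra! hcon
        have := testBit_bitmask.2 hcon.1
        rw [Nat.testBit_xor, testBit_fullMask, this] at hj
        simp [hcon.2] at hj
      rcases hj' with hj' | hj'
      · simpa [gridCell_mem_gridCells] using hj'
      · simpa using notMem_gridCells hin (p := gridCell j) (by simp only [gridCell]; omega)
    obtain ⟨_, hil, _⟩ := id hi
    rcases hij with rfl | rfl | rfl | rfl
    -- A wrapping step is not an adjacency, but it lands in a border column, whose cells are joined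
    -- to the origin anyway.
    · by_cases hb : i % 32 = 31
      · exact joined_compl_gridCells hin (by simp only [gridCell]; omega)
      · refine hi.trans (.of_adj hil hjl ?_)
        rw [gridCell_add_one hb]
        exact cellGraph_adj_right _
    · by_cases hb : j % 32 = 31
      · exact joined_compl_gridCells hin (by simp only [gridCell]; omega)
      · refine hi.trans (.of_adj hil hjl ?_)
        rw [gridCell_add_one hb]
        exact (cellGraph_adj_right _).symm
    · refine hi.trans (.of_adj hil hjl ?_)
      rw [gridCell_add_side]
      exact cellGraph_adj_up _
    · refine hi.trans (.of_adj hil hjl ?_)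
      rw [gridCell_add_side]
      exact (cellGraph_adj_up _).symm
  · intro i hi
    have : i = 0 := by
      simpa [eq_comm] using (testBit_one_shiftLeft 0 i).symm.trans hi
    subst this
    exact joined_compl_gridCells hin (by simp [gridCell])

theorem isPolyomino_gridCells {l : List ℕ} (hl : l ≠ []) (h : isPolyominoCode l = true) :
    IsPolyomino (gridCells l) := by
  simp only [isPolyominoCode, Bool.and_eq_true, List.all_eq_true, beq_iff_eq] at h
  exact ⟨connected_gridCells hl h.1.1 h.1.2, connected_compl_gridCells h.1.1 h.2⟩

/-! ## Squares in space -/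

/-- The two coordinate directions that span the squares orthogonal to the axis number `k`. -/
def axisSides : ℕ → (ℤ × ℤ × ℤ) × (ℤ × ℤ × ℤ)
  | 0 => ((0, 1, 0), (0, 0, 1))
  | 1 => ((1, 0, 0), (0, 0, 1))
  | _ => ((1, 0, 0), (0, 1, 0))

/-- A vertex of the parallelogram with corner `o` and sides `u`, `v`, followed by the two sides
issuing from it, in one of the eight possible ways. -/
def turnFrame (o u v : ℤ × ℤ × ℤ) : ℕ → (ℤ × ℤ × ℤ) × (ℤ × ℤ × ℤ) × (ℤ × ℤ × ℤ)
  | 0 => (o, u, v)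
  | 1 => (o, v, u)
  | 2 => (o + u, -u, v)
  | 3 => (o + u, v, -u)
  | 4 => (o + v, u, -v)
  | 5 => (o + v, -v, u)
  | 6 => (o + u + v, -u, -v)
  | _ => (o + u + v, -v, -u)

/-- The lower left vertex of the square with code `n`. -/
def tileBase (n : ℕ) : ℤ × ℤ × ℤ := ((n / 24 % 6 : ℕ), (n / 144 % 6 : ℕ), (n / 864 : ℕ))

/-- The sides of the square with code `n`. -/
def tileSides (n : ℕ) : (ℤ × ℤ × ℤ) × (ℤ × ℤ × ℤ) := axisSides (n / 8 % 3)

/-- The image of the lower left vertex of a cell and of the directions `(1, 0)` and `(0, 1)`,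
when the cell is carried to space by the isometry with code `n`. -/
def tileFrame (n : ℕ) : (ℤ × ℤ × ℤ) × (ℤ × ℤ × ℤ) × (ℤ × ℤ × ℤ) :=
  turnFrame (tileBase n) (tileSides n).1 (tileSides n).2 (n % 8)

theorem quad_swap (o u v : ℤ × ℤ × ℤ) : quad o v u = quad o u v := by
  ext w
  simp only [quad, Finset.mem_insert, Finset.mem_singleton, add_right_comm o v u]
  tauto

theorem quad_neg (o u v : ℤ × ℤ × ℤ) : quad (o + u) (-u) v = quad o u v := by
  ext w
  simp only [quad, Finset.mem_insert, Finset.mem_singleton, add_neg_cancel_right]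
  tauto

/-- Swapping the two sides and reversing one of them from its other end generate all eight frames,
and neither changes the vertex set. -/
theorem quad_turnFrame (o u v : ℤ × ℤ × ℤ) (k : ℕ) :
    quad (turnFrame o u v k).1 (turnFrame o u v k).2.1 (turnFrame o u v k).2.2 = quad o u v := by
  unfold turnFrame
  split
  · rfl
  · exact quad_swap o u v
  · exact quad_neg o u v
  · exact (quad_swap _ _ _).trans (quad_neg o u v)
  · exact (quad_swap _ _ _).trans ((quad_neg o v u).trans (quad_swap _ _ _))
  · exact (quad_neg o v u).trans (quad_swap _ _ _)
  · rw [add_right_comm]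
    exact (quad_neg _ u _).trans ((quad_swap _ _ _).trans ((quad_neg o v u).trans
      (quad_swap _ _ _)))
  · rw [quad_swap, add_right_comm]
    exact (quad_neg _ u _).trans ((quad_swap _ _ _).trans ((quad_neg o v u).trans
      (quad_swap _ _ _)))

theorem quad_tileFrame (n : ℕ) :
    quad (tileFrame n).1 (tileFrame n).2.1 (tileFrame n).2.2 =
      quad (tileBase n) (tileSides n).1 (tileSides n).2 :=
  quad_turnFrame _ _ _ _

theorem tileFrame_isometric (n : ℕ) :
    dot (tileFrame n).2.1 (tileFrame n).2.1 = 1 ∧ dot (tileFrame n).2.2 (tileFrame n).2.2 = 1 ∧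
      dot (tileFrame n).2.1 (tileFrame n).2.2 = 0 := by
  unfold tileFrame tileSides axisSides turnFrame
  split <;> split <;> simp [dot]

/-- The four vertices are distinct, so the sum over the set is `4o + 2u + 2v`. -/
theorem sum_quad_axisSides (o : ℤ × ℤ × ℤ) (k : ℕ) :
    ∑ w ∈ quad o (axisSides k).1 (axisSides k).2, w =
      o + (o + (axisSides k).1) + (o + (axisSides k).2) +
        (o + (axisSides k).1 + (axisSides k).2) := by
  obtain ⟨x, y, z⟩ := o
  unfold axisSides quad
  split <;>
  · rw [Finset.sum_insert (by simp), Finset.sum_insert (by simp), Finset.sum_insert (by simp),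
      Finset.sum_singleton]
    abel

/-- The vertex sum determines the square: modulo 4 its coordinates are 2 along the sides and 0 along
the normal, which gives the axis, and then the least vertex follows. These are exactly the digits of
`n / 8`. -/
theorem tileKey_eq {m n : ℕ}
    (h : quad (tileBase m) (tileSides m).1 (tileSides m).2 =
      quad (tileBase n) (tileSides n).1 (tileSides n).2) : m / 8 = n / 8 := by
  have hs := congrArg (fun s => ∑ w ∈ s, w) h
  simp only [tileSides, sum_quad_axisSides] at hs
  have hm : m / 8 % 3 = 0 ∨ m / 8 % 3 = 1 ∨ m / 8 % 3 = 2 := by omega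
  have hn : n / 8 % 3 = 0 ∨ n / 8 % 3 = 1 ∨ n / 8 % 3 = 2 := by omega
  rcases hm with hm | hm | hm <;> rcases hn with hn | hn | hn <;>
  · simp only [hm, hn, axisSides, tileBase, Prod.mk_add_mk, Prod.mk.injEq] at hs
    omega

/-! ## Nets of boxes -/

/-- The square with code `n` belongs to the surface of the box `B`. -/
def isSurfaceTile (B : ℕ × ℕ × ℕ) (n : ℕ) : Bool :=
  let x := n / 24 % 6
  let y := n / 144 % 6
  let z := n / 864
  match n / 8 % 3 with
  | 0 => (Nat.beq x 0 || Nat.beq x B.1) && Nat.blt y B.2.1 && Nat.blt z B.2.2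
  | 1 => Nat.blt x B.1 && (Nat.beq y 0 || Nat.beq y B.2.1) && Nat.blt z B.2.2
  | _ => Nat.blt x B.1 && Nat.blt y B.2.1 && (Nat.beq z 0 || Nat.beq z B.2.2)

theorem quad_mem_surfaceSquares {B : ℕ × ℕ × ℕ} {n : ℕ} (h : isSurfaceTile B n = true) :
    quad (tileBase n) (tileSides n).1 (tileSides n).2 ∈ surfaceSquares B := by
  simp only [isSurfaceTile] at h
  simp only [surfaceSquares, Finset.mem_union, Finset.mem_image]
  unfold tileSides axisSides
  split at h <;> rename_i hk <;>
    simp only [Bool.and_eq_true, Bool.or_eq_true, Nat.beq_eq, Nat.blt_eq] at h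
  · refine .inl (.inl ⟨tileBase n, ?_, by simp⟩)
    simp only [tileBase, Finset.mem_product, Finset.mem_insert, Finset.mem_singleton,
      Finset.mem_Ico]
    omega
  · refine .inl (.inr ⟨tileBase n, ?_, by simp⟩)
    simp only [tileBase, Finset.mem_product, Finset.mem_insert, Finset.mem_singleton,
      Finset.mem_Ico]
    omega
  · refine .inr ⟨tileBase n, ?_, ?_⟩
    · simp only [tileBase, Finset.mem_product, Finset.mem_insert, Finset.mem_singleton,
        Finset.mem_Ico]
      omega
    · rfl

/-- An upper bound is enough for the counting argument, so it need not be shown that the listed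
squares are distinct, nor that `0` and the side length differ. -/
theorem card_surfaceSquares_le (B : ℕ × ℕ × ℕ) :
    (surfaceSquares B).card ≤ 2 * (B.1 * B.2.1 + B.1 * B.2.2 + B.2.1 * B.2.2) := by
  have hpair : ∀ k : ℤ, ({0, k} : Finset ℤ).card ≤ 2 := fun k => Finset.card_le_two
  have h₁ := Nat.mul_le_mul_right (B.2.1 * B.2.2) (hpair B.1)
  have h₂ := Nat.mul_le_mul_left B.1 (Nat.mul_le_mul_right B.2.2 (hpair B.2.1))
  have h₃ := Nat.mul_le_mul_left B.1 (Nat.mul_le_mul_left B.2.1 (hpair B.2.2))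
  refine (Finset.card_union_le _ _).trans ((Nat.add_le_add ((Finset.card_union_le _ _).trans
    (Nat.add_le_add Finset.card_image_le Finset.card_image_le)) Finset.card_image_le).trans ?_)
  simp only [Finset.card_product, Int.card_Ico, sub_zero, Int.toNat_natCast]
  linarith

/-- A cell and the cell to its right, carried to space by the isometries with codes `m` and `n`,
agree on their common edge. -/
def gluesRight (m n : ℕ) : Bool :=
  let f := tileFrame m
  let g := tileFrame n
  decide (f.1 + f.2.1 = g.1) && decide (f.1 + f.2.1 + f.2.2 = g.1 + g.2.2)

/-- A cell and the cell above it, carried to space by the isometries with codes `m` and `n`,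
agree on their common edge. -/
def gluesUp (m n : ℕ) : Bool :=
  let f := tileFrame m
  let g := tileFrame n
  decide (f.1 + f.2.2 = g.1) && decide (f.1 + f.2.1 + f.2.2 = g.1 + g.2.1)

/-- The list of pairs (index of a cell, code of an isometry) describes a folding of the set of
these cells onto the box `B`. -/
def isNetCode (B : ℕ × ℕ × ℕ) (L : List (ℕ × ℕ)) : Bool :=
  Nat.beq L.length (2 * (B.1 * B.2.1 + B.1 * B.2.2 + B.2.1 * B.2.2)) &&
  nodupFrom 0 (L.map fun e => e.1) && nodupFrom 0 (L.map fun e => e.2 / 8) &&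
  (L.all fun e => isSurfaceTile B e.2) &&
  L.all fun e => L.all fun e' =>
    (!Nat.beq e'.1 (e.1 + 1) || gluesRight e.2 e'.2) &&
    (!Nat.beq e'.1 (e.1 + 32) || gluesUp e.2 e'.2)

/-- Distinct indices make the certificate a function on cells. The default value 0 elsewhere is
harmless, since a folding is constrained only on the cells of the net. -/
theorem exists_tile_of_nodup {L : List (ℕ × ℕ)} (h : (L.map fun e => e.1).Nodup) :
    ∃ F : ℤ × ℤ → ℕ, ∀ e ∈ L, F (gridCell e.1) = e.2 := by
  classical
  refine ⟨fun p => if hp : ∃ e ∈ L, gridCell e.1 = p then hp.choose.2 else 0, fun e he => ?_⟩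
  have hp : ∃ e' ∈ L, gridCell e'.1 = gridCell e.1 := ⟨e, he, rfl⟩
  simp only [dif_pos hp]
  exact congrArg Prod.snd
    (List.inj_on_of_nodup_map h hp.choose_spec.1 he (gridCell_injective hp.choose_spec.2))

theorem nonempty_folding_of_isNetCode {B : ℕ × ℕ × ℕ} {L : List (ℕ × ℕ)}
    (h : isNetCode B L = true) : Nonempty (Folding (gridCells (L.map fun e => e.1)) B) := by
  simp only [isNetCode, Bool.and_eq_true, Nat.beq_eq, List.all_eq_true, Bool.or_eq_true,
    Bool.not_eq_true', gluesRight, gluesUp, decide_eq_true_eq] at h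
  obtain ⟨⟨⟨⟨hlen, hcells⟩, htiles⟩, hsurf⟩, hglue⟩ := h
  have hcells := (nodup_of_nodupFrom hcells).1
  have htiles := (nodup_of_nodupFrom htiles).1
  obtain ⟨F, hF⟩ := exists_tile_of_nodup hcells
  have hP : ∀ p ∈ gridCells (L.map fun e => e.1), ∃ e ∈ L, p = gridCell e.1 ∧ F p = e.2 := by
    intro p hp
    obtain ⟨i, hi, rfl⟩ := mem_gridCells.1 hp
    obtain ⟨e, he, rfl⟩ := List.mem_map.1 hi
    exact ⟨e, he, rfl, hF e he⟩
  have hbeq : ∀ i : ℕ, Nat.beq i i ≠ false := by simp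
  have hmaps : ∀ p ∈ gridCells (L.map fun e => e.1),
      quad (tileFrame (F p)).1 (tileFrame (F p)).2.1 (tileFrame (F p)).2.2 ∈
        surfaceSquares B := by
    intro p hp
    obtain ⟨e, he, -, hFp⟩ := hP p hp
    rw [quad_tileFrame, hFp]
    exact quad_mem_surfaceSquares (hsurf e he)
  have hinj : Set.InjOn
      (fun p => quad (tileFrame (F p)).1 (tileFrame (F p)).2.1 (tileFrame (F p)).2.2)
      (gridCells (L.map fun e => e.1) : Set (ℤ × ℤ)) := by
    intro p hp q hq hpq
    obtain ⟨e, he, rfl, hFp⟩ := hP p hp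
    obtain ⟨e', he', rfl, hFq⟩ := hP q hq
    simp only [quad_tileFrame, hFp, hFq] at hpq
    rw [List.inj_on_of_nodup_map htiles he he' (tileKey_eq hpq)]
  refine ⟨⟨fun p => (tileFrame (F p)).1, fun p => (tileFrame (F p)).2.1,
    fun p => (tileFrame (F p)).2.2, fun p _ => tileFrame_isometric _, ?_, ?_,
    fun p hp => hmaps p hp, hinj, ?_⟩⟩
  · intro p hp hq
    obtain ⟨e, he, rfl, hFp⟩ := hP p hp
    obtain ⟨e', he', heq, hFq⟩ := hP _ hq
    rw [hFp, hFq]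
    -- The test is guarded by equality of indices, which holds for every truly adjacent pair; a pair
    -- adjacent only by wrapping would merely be tested needlessly.
    exact (hglue e he e' he').1.resolve_left
      (by rw [gridCell_eq_add_right heq.symm]; exact hbeq _)
  · intro p hp hq
    obtain ⟨e, he, rfl, hFp⟩ := hP p hp
    obtain ⟨e', he', heq, hFq⟩ := hP _ hq
    rw [hFp, hFq]
    exact (hglue e he e' he').2.resolve_left
      (by rw [gridCell_eq_add_up heq.symm]; exact hbeq _)
  -- Surjectivity by counting: there are as many cells as the surface area, hence at least as many
  -- as surface squares.
  · refine Finset.surjOn_of_injOn_of_card_le _ (fun p hp => hmaps p hp) hinj ?_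
    refine (card_surfaceSquares_le B).trans (hlen.symm.le.trans ?_)
    rw [gridCells, List.toFinset_card_of_nodup (hcells.map gridCell_injective), List.length_map,
      List.length_map]

/-! ## Common unfoldings of two boxes -/

/-- The list of triples (index of a cell, codes of two isometries) describes a polyomino and
foldings of it onto the boxes `B₁` and `B₂`. -/
def isCommonNetCode (B₁ B₂ : ℕ × ℕ × ℕ) (L : List (ℕ × ℕ × ℕ)) : Bool :=
  !L.isEmpty && isPolyominoCode (L.map fun e => e.1) &&
    isNetCode B₁ (L.map fun e => (e.1, e.2.1)) && isNetCode B₂ (L.map fun e => (e.1, e.2.2))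

theorem hasCommonUnfolding_of_isCommonNetCode {B₁ B₂ : ℕ × ℕ × ℕ} {L : List (ℕ × ℕ × ℕ)}
    (h : isCommonNetCode B₁ B₂ L = true) : HasCommonUnfolding {B₁, B₂} := by
  simp only [isCommonNetCode, Bool.and_eq_true, Bool.not_eq_true', List.isEmpty_eq_false_iff] at h
  obtain ⟨⟨⟨hne, hP⟩, h₁⟩, h₂⟩ := h
  have h₁ := nonempty_folding_of_isNetCode h₁
  have h₂ := nonempty_folding_of_isNetCode h₂
  -- Both projections of the certificate keep the cell indices, so the two foldings start from
  -- literally the same polyomino.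
  simp only [List.map_map, Function.comp_def] at h₁ h₂
  refine ⟨_, isPolyomino_gridCells (by simpa using hne) hP, ?_⟩
  rintro B (rfl | rfl)
  · exact h₁
  · exact h₂

/-! ## Common unfoldings of boxes of equal surface area -/

/-- How to read an entry: in `(33, 3610, 866)` the cell is `(1, 1)`. Since `3610 = 8 * (3 * (0 + 6 *
1 + 36 * 4) + 1) + 2`, it covers on the first box the square orthogonal to the second axis with
least vertex `(0, 1, 4)`, in frame 2; likewise `866` is the square orthogonal to the first axis at
`(0, 0, 1)`, in frame 2. -/
theorem hasCommonUnfolding_1_1_5_1_2_3 :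
    HasCommonUnfolding {(1, 1, 5), (1, 2, 3)} :=
  hasCommonUnfolding_of_isCommonNetCode (L := [
    (33, 3610, 866), (65, 4342, 1730), (66, 3463, 1736), (98, 3469, 2608), (99, 2605, 1757),
    (100, 1741, 893), (130, 3485, 2752), (131, 2621, 1901), (132, 1757, 1037), (133, 893, 173),
    (136, 27, 27), (163, 2751, 2031), (164, 1887, 1167), (165, 1023, 303), (166, 159, 167),
    (167, 23, 23), (168, 11, 11), (169, 875, 875), (195, 2599, 1879), (196, 1735, 1015),
    (197, 871, 151), (200, 1, 1)])
    (by decide +kernel)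

theorem hasCommonUnfolding_1_1_7_1_3_3 :
    HasCommonUnfolding {(1, 1, 7), (1, 3, 3)} :=
  hasCommonUnfolding_of_isCommonNetCode (L := [
    (33, 156, 2613), (65, 20, 1758), (66, 27, 1742), (98, 11, 878), (130, 1, 14), (131, 865, 4),
    (132, 1729, 148), (163, 1017, 17), (164, 1881, 161), (165, 2745, 305), (195, 891, 24),
    (196, 1755, 168), (227, 875, 888), (228, 1739, 1032), (229, 2603, 1176), (230, 3467, 1306),
    (233, 4322, 317), (261, 2593, 2040), (262, 3457, 2170), (265, 5186, 447), (294, 3609, 2902),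
    (295, 4473, 2023), (296, 5337, 1159), (297, 6069, 295), (325, 2619, 1899), (326, 3483, 2758),
    (327, 4347, 1879), (328, 5211, 1015), (359, 4331, 1735), (360, 5195, 871)])
    (by decide +kernel)

theorem hasCommonUnfolding_1_1_8_1_2_5 :
    HasCommonUnfolding {(1, 1, 8), (1, 2, 5)} :=
  hasCommonUnfolding_of_isCommonNetCode (L := [
    (33, 6059, 4342), (37, 4333, 4485), (65, 6049, 3470), (66, 6928, 3460), (67, 6077, 3604),
    (68, 5213, 3756), (69, 4349, 3630), (70, 3485, 3486), (99, 6207, 2740), (100, 5343, 2892),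
    (101, 4479, 2766), (102, 3615, 2622), (103, 2751, 2606), (104, 1887, 2596),
    (132, 5191, 2028), (133, 4327, 1902), (134, 3463, 1758), (135, 2599, 1742),
    (136, 1735, 1732), (137, 871, 1876), (164, 5197, 1164), (166, 3469, 894), (167, 2605, 878),
    (168, 1741, 868), (169, 877, 1012), (171, 14, 1038), (199, 2621, 14), (200, 1757, 4),
    (201, 893, 148), (202, 29, 300), (203, 18, 174), (204, 1, 30), (233, 1023, 161),
    (236, 153, 23)])
    (by decide +kernel)

theorem hasCommonUnfolding_1_1_9_1_3_4 :
    HasCommonUnfolding {(1, 1, 9), (1, 3, 4)} :=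
  hasCommonUnfolding_of_isCommonNetCode (L := [
    (37, 17, 3033), (38, 153, 3765), (39, 1017, 3621), (41, 2745, 3478), (67, 2, 1179),
    (68, 8, 2043), (69, 24, 2907), (71, 891, 2766), (72, 1755, 2622), (73, 2619, 2606),
    (74, 3483, 2596), (99, 866, 1035), (100, 872, 1899), (106, 3467, 1732), (130, 1882, 27),
    (131, 1730, 891), (132, 1736, 1755), (163, 2594, 875), (164, 2600, 1739), (194, 3610, 1),
    (195, 3458, 865), (226, 4474, 145), (227, 4322, 1009), (228, 4328, 1873), (229, 4344, 2737),
    (258, 5338, 289), (259, 5186, 1153), (260, 5192, 2017), (261, 5208, 2881), (289, 6072, 305),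
    (290, 6202, 441), (291, 6050, 1305), (292, 6056, 2169), (322, 7066, 315), (353, 6939, 164),
    (354, 7798, 171), (385, 6923, 20), (417, 6913, 8)])
    (by decide +kernel)

theorem hasCommonUnfolding_1_2_6_2_2_4 :
    HasCommonUnfolding {(1, 2, 6), (2, 2, 4)} :=
  hasCommonUnfolding_of_isCommonNetCode (L := [
    (35, 4, 20), (36, 148, 44), (67, 17, 8), (68, 161, 32), (98, 8, 866), (99, 24, 872),
    (100, 168, 896), (101, 298, 912), (129, 866, 1874), (130, 872, 1730), (131, 888, 1736),
    (132, 1032, 1760), (133, 1162, 1776), (134, 1010, 1920), (161, 1730, 2738),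
    (162, 1736, 2594), (163, 1752, 2600), (164, 1896, 2624), (165, 2026, 2640),
    (166, 1874, 2784), (197, 2890, 3499), (198, 2738, 3643), (199, 2594, 2919),
    (200, 2600, 2055), (201, 2616, 1191), (202, 2760, 327), (229, 3754, 3475), (230, 3602, 3619),
    (231, 3458, 2895), (232, 3464, 2031), (233, 3480, 1167), (234, 3624, 303), (265, 4344, 1015),
    (266, 4488, 151), (267, 4618, 164), (268, 4466, 188), (269, 4322, 195), (270, 4328, 1059),
    (298, 5347, 7), (301, 5205, 51)])
    (by decide +kernel)

theorem hasCommonUnfolding_1_1_10_2_3_3 :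
    HasCommonUnfolding {(1, 1, 10), (2, 3, 3)} :=
  hasCommonUnfolding_of_isCommonNetCode (L := [
    (34, 7805, 11), (35, 6941, 875), (37, 5213, 1736), (38, 4349, 1760), (65, 8659, 18),
    (66, 7935, 1), (67, 7071, 865), (68, 6207, 1729), (69, 5343, 2608), (70, 4479, 2632),
    (71, 3615, 1781), (98, 7783, 145), (99, 6919, 1009), (100, 6055, 1873), (101, 5191, 2752),
    (102, 4327, 2776), (103, 3463, 1925), (104, 2599, 1061), (105, 1735, 197), (130, 7789, 289),
    (131, 6925, 1153), (132, 6061, 2017), (133, 5197, 2896), (134, 4333, 2920),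
    (135, 3469, 2069), (136, 2605, 1205), (137, 1741, 341), (141, 11, 51), (142, 875, 915),
    (164, 6077, 2169), (167, 3485, 2199), (168, 2621, 1335), (169, 1757, 471), (170, 893, 335),
    (171, 29, 191), (172, 18, 47), (173, 1, 35), (174, 865, 899), (200, 2751, 1311),
    (201, 1887, 447), (202, 1023, 311), (203, 159, 167)])
    (by decide +kernel)

theorem hasCommonUnfolding_1_1_11_1_2_7 :
    HasCommonUnfolding {(1, 1, 11), (1, 2, 7)} :=
  hasCommonUnfolding_of_isCommonNetCode (L := [
    (45, 8799, 5355), (46, 7935, 6214), (77, 8647, 5211), (78, 7783, 6070), (79, 6919, 5191),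
    (108, 9525, 4331), (109, 8653, 5195), (140, 8670, 4321), (172, 7806, 4465),
    (173, 7790, 5329), (203, 7068, 3753), (204, 6942, 4617), (205, 6926, 5481),
    (233, 6062, 1899), (234, 6052, 2763), (235, 6204, 3627), (236, 6078, 4491),
    (265, 5198, 1755), (266, 5188, 2619), (267, 5340, 3483), (268, 5214, 4347), (295, 4476, 11),
    (296, 4350, 875), (297, 4334, 1739), (298, 4324, 2603), (324, 3486, 893), (325, 3470, 29),
    (326, 3460, 18), (327, 3612, 1), (356, 2622, 1037), (357, 2606, 173), (358, 2596, 162),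
    (359, 2748, 145), (386, 1732, 2895), (387, 1884, 2031), (388, 1758, 1167), (389, 1742, 303),
    (417, 878, 3607), (418, 868, 2743), (419, 1020, 1879), (420, 894, 1015), (449, 14, 3463),
    (450, 4, 2599), (451, 156, 1735), (452, 30, 871), (481, 18, 3469)])
    (by decide +kernel)

/-- Area 46 is shared by three boxes. Each pair has a certificate of its own; nothing is claimed
about the triple. -/
theorem hasCommonUnfolding_1_1_11_1_3_5 :
    HasCommonUnfolding {(1, 1, 11), (1, 3, 5)} :=
  hasCommonUnfolding_of_isCommonNetCode (L := [
    (36, 8669, 2887), (68, 8799, 2743), (69, 7935, 1879), (99, 9526, 3463), (100, 8647, 2599),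
    (131, 8654, 3469), (162, 7806, 4336), (163, 7790, 3485), (164, 7780, 2621),
    (193, 7068, 3601), (194, 6942, 4480), (195, 6926, 3629), (196, 6916, 2765),
    (225, 6204, 3745), (226, 6078, 4624), (227, 6062, 3773), (228, 6052, 2909),
    (258, 5214, 3900), (260, 5188, 3039), (261, 5340, 2175), (263, 5198, 447), (293, 4476, 2023),
    (294, 4350, 1159), (295, 4334, 295), (296, 4324, 308), (326, 3486, 1015), (327, 3470, 151),
    (328, 3460, 164), (329, 3612, 171), (357, 2748, 1735), (358, 2622, 871), (359, 2606, 7),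
    (360, 2596, 20), (390, 1758, 877), (392, 1732, 8), (393, 1884, 24), (395, 1742, 312),
    (425, 1020, 888), (426, 894, 1032), (427, 878, 1176), (428, 868, 1306), (456, 4, 1736),
    (457, 156, 1752), (458, 30, 1896), (459, 14, 2040), (488, 17, 2600)])
    (by decide +kernel)

theorem hasCommonUnfolding_1_2_7_1_3_5 :
    HasCommonUnfolding {(1, 2, 7), (1, 3, 5)} :=
  hasCommonUnfolding_of_isCommonNetCode (L := [
    (38, 3629, 2621), (39, 2765, 1757), (40, 1901, 893), (69, 4623, 3629), (70, 3759, 2765),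
    (71, 2895, 1901), (72, 2031, 1037), (73, 1167, 173), (102, 3607, 2909), (103, 2743, 2045),
    (104, 1879, 1181), (133, 4327, 3903), (134, 3463, 3039), (135, 2599, 2175),
    (136, 1735, 1311), (138, 7, 444), (163, 6069, 3771), (164, 5197, 4630), (165, 4333, 3751),
    (166, 3469, 2887), (167, 2605, 2023), (168, 1741, 1159), (169, 877, 295), (170, 13, 308),
    (171, 17, 315), (196, 5213, 4486), (197, 4349, 3607), (198, 3485, 2743), (199, 2621, 1879),
    (200, 1757, 1015), (201, 893, 151), (202, 29, 164), (227, 6208, 3483), (228, 5357, 4342),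
    (229, 4493, 3463), (233, 1037, 7), (234, 173, 20), (235, 162, 27), (257, 5188, 1739),
    (258, 5332, 2603), (259, 5484, 3467), (267, 298, 11), (268, 146, 875), (290, 4468, 2593),
    (300, 1010, 865), (301, 866, 1729)])
    (by decide +kernel)

theorem hasCommonUnfolding_1_4_4_2_2_5 :
    HasCommonUnfolding {(1, 4, 4), (2, 2, 5)} :=
  hasCommonUnfolding_of_isCommonNetCode (L := [
    (33, 2043, 2606), (34, 2907, 2596), (35, 3766, 2740), (66, 2763, 1732), (67, 3622, 1876),
    (68, 2743, 2028), (69, 1879, 2052), (100, 2599, 1164), (101, 1735, 1188), (132, 2605, 300),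
    (133, 1741, 324), (137, 11, 2913), (138, 875, 3777), (163, 3472, 151), (164, 2621, 164),
    (165, 1757, 188), (166, 893, 195), (167, 29, 1059), (168, 18, 1923), (169, 1, 2787),
    (170, 865, 3651), (197, 1901, 44), (198, 1037, 51), (199, 173, 915), (200, 162, 1779),
    (201, 145, 2643), (202, 1009, 3507), (230, 1181, 35), (231, 317, 899), (232, 306, 1763),
    (233, 289, 2627), (234, 1153, 3491), (235, 2017, 4363), (236, 2881, 4507), (261, 2189, 23),
    (262, 1325, 11), (263, 461, 875), (264, 450, 1739), (266, 1297, 3467), (267, 2161, 4339),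
    (268, 3025, 4483), (269, 3904, 3759), (270, 3053, 2895), (294, 1455, 1), (295, 591, 865),
    (299, 2313, 3460), (300, 3177, 3604), (327, 439, 1009)])
    (by decide +kernel)

theorem hasCommonUnfolding_1_2_8_2_3_4 :
    HasCommonUnfolding {(1, 2, 8), (2, 3, 4)} :=
  hasCommonUnfolding_of_isCommonNetCode (L := [
    (34, 5481, 871), (36, 6346, 4), (65, 4491, 1741), (66, 5355, 877), (67, 6219, 13),
    (68, 7078, 17), (69, 6199, 161), (100, 6934, 41), (131, 6078, 32), (132, 6062, 48),
    (133, 6052, 192), (163, 5214, 896), (164, 5198, 912), (165, 5188, 1056), (166, 5332, 1200),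
    (195, 4350, 1760), (196, 4334, 1776), (197, 4324, 1920), (198, 4468, 2064),
    (199, 4620, 2194), (228, 3470, 2640), (229, 3460, 2784), (230, 3604, 2928),
    (231, 3756, 3058), (232, 3630, 3034), (233, 3486, 2882), (259, 2622, 2627),
    (260, 2606, 3499), (261, 2596, 3643), (262, 2740, 3787), (264, 2766, 3766),
    (292, 1742, 3475), (293, 1732, 3619), (323, 894, 2606), (324, 878, 2596), (325, 868, 2740),
    (356, 14, 1732), (357, 4, 1876), (358, 148, 2020), (359, 300, 2172), (389, 17, 1012),
    (390, 161, 1156), (421, 24, 148), (422, 168, 292), (454, 1032, 305), (455, 1162, 441),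
    (456, 1010, 1305), (485, 1752, 185), (486, 1896, 329), (487, 2026, 465), (488, 1874, 1329),
    (519, 2890, 339)])
    (by decide +kernel)

theorem hasCommonUnfolding_1_1_13_1_3_6 :
    HasCommonUnfolding {(1, 1, 13), (1, 3, 6)} :=
  hasCommonUnfolding_of_isCommonNetCode (L := [
    (33, 9657, 4331), (65, 9531, 4321), (66, 10395, 5200), (67, 11254, 4349), (99, 10382, 4493),
    (100, 10372, 3629), (101, 10524, 2765), (131, 9518, 4637), (132, 9508, 3773),
    (161, 8796, 5347), (162, 8670, 5491), (163, 8654, 4767), (164, 8644, 3903),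
    (195, 7790, 4615), (196, 7780, 3751), (197, 7932, 2887), (198, 7806, 2023),
    (227, 6926, 4471), (228, 6916, 3607), (229, 7068, 2743), (230, 6942, 1879),
    (260, 6052, 3463), (261, 6204, 2599), (262, 6078, 1735), (263, 6062, 871), (292, 5188, 3469),
    (293, 5340, 2605), (294, 5214, 1741), (295, 5198, 877), (324, 4324, 3485), (325, 4476, 2621),
    (326, 4350, 1757), (327, 4334, 893), (358, 3486, 1901), (359, 3470, 1037), (360, 3460, 173),
    (361, 3612, 162), (389, 2748, 2909), (390, 2622, 2045), (391, 2606, 1181), (392, 2596, 317),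
    (421, 1884, 3039), (422, 1758, 2175), (423, 1742, 1311), (424, 1732, 447), (455, 878, 1159),
    (456, 868, 295), (457, 1020, 308), (487, 14, 1015), (488, 4, 151), (520, 17, 7),
    (521, 153, 20), (553, 27, 8), (554, 891, 24)])
    (by decide +kernel)

theorem hasCommonUnfolding_1_1_13_3_3_3 :
    HasCommonUnfolding {(1, 1, 13), (3, 3, 3)} :=
  hasCommonUnfolding_of_isCommonNetCode (L := [
    (34, 4, 2196), (66, 17, 1332), (97, 8, 444), (98, 24, 468), (99, 154, 492), (130, 888, 332),
    (131, 1018, 356), (132, 866, 363), (133, 872, 1227), (163, 1882, 212), (164, 1730, 219),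
    (165, 1736, 1083), (166, 1752, 1947), (196, 2594, 75), (197, 2600, 939), (198, 2616, 1803),
    (199, 2746, 2662), (227, 3610, 71), (228, 3458, 59), (229, 3464, 923), (230, 3480, 1787),
    (258, 4344, 191), (259, 4474, 47), (260, 4322, 35), (261, 4328, 899), (291, 5338, 23),
    (292, 5186, 11), (293, 5192, 875), (294, 5208, 1739), (324, 6050, 1), (325, 6056, 865),
    (326, 6072, 1729), (327, 6202, 2608), (355, 7066, 162), (356, 6914, 145), (357, 6920, 1009),
    (358, 6936, 1873), (387, 7930, 306), (388, 7778, 289), (389, 7784, 1153), (390, 7800, 2017),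
    (421, 8648, 1305), (422, 8664, 2169), (423, 8794, 2901), (424, 8642, 2757),
    (455, 9658, 2925), (456, 9506, 2781), (457, 9512, 2637), (458, 9528, 1765),
    (487, 10522, 2949), (488, 10370, 2805), (518, 10395, 2220), (519, 11254, 2094),
    (550, 10379, 1356)])
    (by decide +kernel)

theorem hasCommonUnfolding_1_3_6_3_3_3 :
    HasCommonUnfolding {(1, 3, 6), (3, 3, 3)} :=
  hasCommonUnfolding_of_isCommonNetCode (L := [
    (43, 866, 926), (74, 1874, 78), (75, 1730, 62), (76, 1736, 38), (107, 2594, 66),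
    (108, 2600, 42), (109, 2616, 18), (110, 2760, 1), (136, 3898, 1949), (139, 3458, 210),
    (140, 3464, 186), (141, 3480, 162), (168, 4762, 2093), (169, 4610, 1229), (170, 4466, 365),
    (171, 4322, 354), (172, 4328, 330), (173, 4344, 306), (174, 4488, 289), (201, 5493, 1359),
    (202, 5349, 495), (204, 5200, 466), (233, 4638, 1335), (262, 3604, 2194), (263, 3748, 2170),
    (265, 3774, 1311), (266, 3630, 447), (294, 2740, 2926), (295, 2884, 2902), (296, 3036, 2023),
    (297, 2910, 1159), (323, 1758, 2781), (327, 2020, 2758), (328, 2172, 1879),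
    (329, 2046, 1015), (330, 1902, 151), (353, 1182, 2217), (354, 1038, 2949), (355, 894, 2805),
    (356, 878, 2661), (358, 1012, 2638), (359, 1156, 2614), (360, 1308, 1735), (388, 14, 1806),
    (389, 4, 1790), (390, 148, 1766), (391, 292, 1742), (419, 29, 1086), (420, 18, 942),
    (422, 161, 902), (423, 305, 878), (424, 441, 868), (451, 173, 222), (455, 312, 14)])
    (by decide +kernel)

theorem hasCommonUnfolding_1_1_14_1_2_9 :
    HasCommonUnfolding {(1, 1, 14), (1, 2, 9)} :=
  hasCommonUnfolding_of_isCommonNetCode (L := [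
    (33, 23, 303), (34, 11, 167), (35, 875, 23), (66, 1, 146), (67, 865, 2), (68, 1729, 8),
    (69, 2593, 24), (70, 3457, 168), (98, 153, 1010), (99, 1017, 866), (100, 1881, 872),
    (101, 2745, 888), (102, 3609, 1032), (103, 4473, 1162), (130, 27, 1874), (131, 891, 1730),
    (132, 1755, 1736), (133, 2619, 1752), (134, 3483, 1896), (135, 4347, 2026),
    (164, 1739, 2600), (165, 2603, 2616), (166, 3467, 2760), (167, 4331, 2890),
    (168, 5195, 2738), (169, 6059, 2594), (199, 4321, 3754), (200, 5185, 3602),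
    (201, 6049, 3458), (202, 6913, 3464), (203, 7777, 3480), (204, 8641, 3624),
    (232, 5337, 4466), (233, 6201, 4322), (234, 7065, 4328), (235, 7929, 4344),
    (236, 8793, 4488), (237, 9657, 4618), (264, 5211, 5330), (265, 6075, 5186),
    (266, 6939, 5192), (267, 7803, 5208), (268, 8667, 5352), (269, 9531, 5482),
    (298, 6923, 6056), (299, 7787, 6072), (300, 8651, 6216), (301, 9515, 6346),
    (302, 10379, 6194), (333, 9505, 7210), (334, 10369, 7058), (366, 10521, 7941),
    (368, 11386, 7798), (398, 10395, 7086), (399, 11259, 6942), (400, 12118, 6926),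
    (401, 11239, 6916), (433, 11245, 6052)])
    (by decide +kernel)

theorem hasCommonUnfolding_1_1_14_1_4_5 :
    HasCommonUnfolding {(1, 1, 14), (1, 4, 5)} :=
  hasCommonUnfolding_of_isCommonNetCode (L := [
    (41, 6059, 174), (72, 5185, 311), (73, 6049, 167), (74, 6913, 23), (79, 11233, 449),
    (80, 12112, 585), (103, 4473, 434), (104, 5337, 290), (105, 6201, 146), (106, 7065, 2),
    (107, 7929, 8), (108, 8793, 24), (110, 10521, 312), (111, 11385, 456), (134, 3483, 1450),
    (135, 4347, 1298), (136, 5211, 1154), (137, 6075, 1010), (138, 6939, 866), (139, 7803, 872),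
    (140, 8667, 888), (141, 9531, 1032), (142, 10395, 1176), (143, 11259, 1320),
    (166, 3467, 2314), (167, 4331, 2162), (168, 5195, 2018), (170, 6923, 1730),
    (171, 7787, 1736), (172, 8651, 1752), (173, 9515, 1896), (174, 10379, 2040),
    (175, 11243, 2184), (197, 2593, 3048), (198, 3457, 3178), (199, 4321, 3026),
    (203, 7777, 2600), (204, 8641, 2616), (205, 9505, 2760), (206, 10369, 2904),
    (225, 156, 3483), (228, 1881, 3768), (229, 2745, 3912), (230, 3609, 4042), (237, 9657, 3624),
    (257, 20, 3467), (258, 27, 4339), (259, 891, 4483), (260, 1755, 4627), (261, 2619, 4771),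
    (290, 11, 3460), (291, 875, 3604), (292, 1739, 3748), (293, 2603, 3892), (322, 1, 2596),
    (323, 865, 2740), (324, 1729, 2884), (355, 1017, 1876)])
    (by decide +kernel)

theorem hasCommonUnfolding_1_2_9_1_4_5 :
    HasCommonUnfolding {(1, 2, 9), (1, 4, 5)} :=
  hasCommonUnfolding_of_isCommonNetCode (L := [
    (43, 2599, 4047), (44, 1735, 3183), (45, 871, 2319), (46, 7, 1455), (75, 2605, 3895),
    (76, 1741, 3031), (77, 877, 2167), (78, 13, 1303), (107, 2621, 3751), (108, 1757, 2887),
    (109, 893, 2023), (110, 29, 1159), (111, 18, 295), (139, 2765, 3607), (140, 1901, 2743),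
    (141, 1037, 1879), (142, 173, 1015), (143, 162, 151), (171, 2895, 3463), (172, 2031, 2599),
    (173, 1167, 1735), (174, 303, 871), (199, 6199, 4773), (200, 5335, 4629), (201, 4471, 4485),
    (202, 3607, 4341), (203, 2743, 3469), (204, 1879, 2605), (205, 1015, 1741), (206, 151, 877),
    (231, 6055, 3918), (232, 5191, 3774), (233, 4327, 3630), (234, 3463, 3486),
    (263, 6061, 3054), (264, 5197, 2910), (265, 4333, 2766), (266, 3469, 2622),
    (295, 6077, 2190), (296, 5213, 2046), (297, 4349, 1902), (298, 3485, 1758),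
    (327, 6221, 1326), (328, 5357, 1182), (329, 4493, 1038), (330, 3629, 894), (354, 7797, 4),
    (357, 7939, 436), (358, 7215, 588), (359, 6351, 462), (360, 5487, 318), (361, 4623, 174),
    (362, 3759, 30), (385, 7086, 13), (386, 6942, 17), (387, 6926, 161), (388, 6916, 305),
    (389, 7060, 449)])
    (by decide +kernel)

theorem hasCommonUnfolding_1_1_15_1_3_7 :
    HasCommonUnfolding {(1, 1, 15), (1, 3, 7)} :=
  hasCommonUnfolding_of_isCommonNetCode (L := [
    (33, 12107, 866), (65, 12097, 1730), (66, 12976, 1736), (67, 12125, 1752), (68, 11261, 1896),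
    (99, 12255, 2616), (100, 11391, 2760), (101, 10527, 2904), (102, 9663, 3034),
    (132, 11239, 3624), (133, 10375, 3768), (134, 9511, 3898), (135, 8647, 3746),
    (164, 11245, 4488), (165, 10381, 4632), (166, 9517, 4762), (167, 8653, 4610),
    (168, 7789, 4466), (197, 10397, 5496), (198, 9533, 5626), (199, 8669, 5474),
    (200, 7805, 5330), (231, 8799, 6357), (232, 7935, 6213), (233, 7071, 6069),
    (264, 7783, 5358), (265, 6919, 5214), (266, 6055, 5198), (267, 5191, 5188),
    (297, 6925, 4350), (298, 6061, 4334), (299, 5197, 4324), (329, 6941, 3486),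
    (330, 6077, 3470), (331, 5213, 3460), (332, 4349, 3604), (362, 6207, 2606),
    (363, 5343, 2596), (364, 4479, 2740), (365, 3615, 2884), (396, 4327, 1876),
    (397, 3463, 2020), (398, 2599, 2172), (399, 1735, 2046), (428, 4333, 1012),
    (429, 3469, 1156), (430, 2605, 1308), (431, 1741, 1182), (432, 877, 1038), (433, 13, 894),
    (434, 17, 878), (461, 3485, 292), (462, 2621, 444), (463, 1757, 318), (464, 893, 174),
    (466, 24, 14), (467, 154, 4), (468, 2, 148), (494, 2751, 308), (499, 1018, 17),
    (500, 866, 161), (531, 1882, 24)])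
    (by decide +kernel)

theorem hasCommonUnfolding_1_1_15_2_3_5 :
    HasCommonUnfolding {(1, 1, 15), (2, 3, 5)} :=
  hasCommonUnfolding_of_isCommonNetCode (L := [
    (35, 8642, 441), (67, 9506, 465), (68, 9512, 1329), (98, 10522, 332), (99, 10370, 339),
    (130, 11386, 188), (131, 11234, 195), (161, 12120, 20), (162, 12250, 44), (168, 7935, 311),
    (169, 7071, 167), (194, 12982, 32), (195, 12103, 48), (200, 7783, 290), (201, 6919, 146),
    (202, 6055, 2), (203, 5191, 8), (227, 12109, 912), (228, 11245, 1056), (229, 10381, 1200),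
    (231, 8653, 1306), (232, 7789, 1154), (233, 6925, 1010), (234, 6061, 866), (235, 5197, 872),
    (236, 4333, 896), (242, 14, 1765), (260, 11261, 1920), (261, 10397, 2064), (262, 9533, 2194),
    (263, 8669, 2170), (264, 7805, 2018), (265, 6941, 1874), (266, 6077, 1730),
    (267, 5213, 1736), (273, 29, 2645), (274, 18, 1781), (294, 9663, 3058), (295, 8799, 3034),
    (298, 6207, 2594), (299, 5343, 2600), (300, 4479, 2624), (304, 1023, 3653), (305, 159, 2789),
    (332, 4327, 3488), (333, 3463, 3504), (336, 871, 3797), (337, 7, 2933), (365, 3469, 4363),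
    (366, 2605, 4507), (367, 1741, 4651), (368, 877, 3927), (396, 4349, 3467), (397, 3485, 4339),
    (398, 2621, 4483), (399, 1757, 4627), (400, 893, 3903), (429, 3615, 3460), (430, 2751, 3604),
    (431, 1887, 3748), (462, 2599, 2740), (463, 1735, 2884)])
    (by decide +kernel)

theorem hasCommonUnfolding_1_3_7_2_3_5 :
    HasCommonUnfolding {(1, 3, 7), (2, 3, 5)} :=
  hasCommonUnfolding_of_isCommonNetCode (L := [
    (40, 447, 866), (72, 295, 1730), (73, 308, 1736), (74, 315, 1760), (77, 2907, 2064),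
    (78, 3771, 2194), (104, 151, 2594), (105, 164, 2600), (106, 171, 2624), (107, 1035, 2640),
    (108, 1899, 2784), (109, 2763, 2928), (137, 20, 3464), (138, 27, 3488), (139, 891, 3504),
    (140, 1755, 3648), (168, 2, 3457), (169, 8, 4336), (171, 875, 4363), (172, 1739, 4507),
    (196, 1176, 145), (197, 1306, 1009), (198, 1154, 1873), (199, 1010, 2737), (200, 866, 3601),
    (228, 2040, 289), (229, 2170, 1153), (230, 2018, 2017), (231, 1874, 2881), (232, 1730, 3745),
    (261, 3034, 1305), (262, 2882, 2169), (263, 2738, 3033), (264, 2594, 3897),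
    (265, 2600, 4629), (266, 2616, 4485), (290, 3480, 444), (291, 3624, 468), (293, 3898, 1329),
    (295, 3602, 3057), (296, 3458, 3921), (297, 3464, 4653), (322, 4344, 308), (323, 4488, 332),
    (324, 4632, 339), (325, 4762, 1203), (329, 4328, 3798), (354, 5208, 164), (355, 5352, 188),
    (356, 5496, 195), (357, 5626, 1059), (358, 5474, 1923), (386, 6067, 20), (387, 6211, 44),
    (388, 6355, 51), (417, 5198, 2), (418, 5188, 8), (419, 5332, 32), (450, 4324, 872),
    (451, 4468, 896), (452, 4612, 912), (484, 3748, 1776)])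
    (by decide +kernel)

theorem hasCommonUnfolding_1_2_10_2_2_7 :
    HasCommonUnfolding {(1, 2, 10), (2, 2, 7)} :=
  hasCommonUnfolding_of_isCommonNetCode (L := [
    (36, 6196, 4471), (37, 6348, 3607), (67, 5188, 5191), (68, 5332, 4327), (69, 5484, 3463),
    (70, 5358, 2599), (99, 4324, 5197), (100, 4468, 4333), (101, 4620, 3469), (102, 4494, 2605),
    (130, 3470, 6093), (131, 3460, 5221), (132, 3604, 4357), (163, 2596, 5237),
    (164, 2740, 4373), (195, 1732, 5381), (196, 1876, 4517), (226, 878, 6235), (227, 868, 5511),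
    (257, 30, 6067), (258, 14, 6211), (290, 18, 5332), (291, 1, 5484), (323, 145, 4620),
    (324, 1009, 4644), (355, 297, 3756), (356, 1161, 3780), (357, 2025, 3654), (358, 2889, 3510),
    (359, 3753, 3494), (386, 164, 2740), (387, 171, 2892), (388, 1035, 2916), (389, 1899, 2790),
    (390, 2763, 2646), (391, 3627, 2630), (420, 891, 2052), (421, 1755, 1926), (422, 2619, 1782),
    (423, 3483, 1766), (424, 4347, 1742), (425, 5211, 1732), (426, 6075, 1876),
    (427, 6939, 2028), (453, 1739, 1062), (454, 2603, 918), (456, 4331, 878), (457, 5195, 868),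
    (458, 6059, 1012), (459, 6923, 1164), (460, 7787, 1188), (490, 6049, 148), (491, 6913, 300),
    (492, 7777, 324), (493, 8656, 198), (523, 7057, 164), (524, 7921, 188), (556, 8073, 44),
    (557, 8805, 51), (589, 7950, 35), (590, 7806, 899), (620, 7212, 23), (621, 7086, 11),
    (653, 6222, 1)])
    (by decide +kernel)

theorem hasCommonUnfolding_1_2_10_2_4_4 :
    HasCommonUnfolding {(1, 2, 10), (2, 4, 4)} :=
  hasCommonUnfolding_of_isCommonNetCode (L := [
    (40, 4321, 3790), (41, 5185, 3766), (73, 5329, 3622), (102, 2889, 3645), (103, 3753, 3501),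
    (105, 5481, 3478), (110, 8079, 3904), (111, 7215, 3928), (112, 6351, 3077), (131, 171, 3204),
    (133, 1899, 2934), (134, 2763, 2790), (135, 3627, 2646), (136, 4491, 2630),
    (137, 5355, 2606), (138, 6219, 2596), (139, 7083, 2740), (140, 7947, 2884),
    (141, 8806, 3028), (142, 7927, 3180), (161, 7, 2164), (162, 20, 2316), (163, 27, 2340),
    (164, 891, 2214), (165, 1755, 2070), (166, 2619, 1926), (167, 3483, 1782), (168, 4347, 1766),
    (169, 5211, 1742), (170, 6075, 1732), (171, 6939, 1876), (172, 7803, 2020), (195, 11, 1476),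
    (196, 875, 1350), (197, 1739, 1206), (198, 2603, 1062), (199, 3467, 918), (200, 4331, 902),
    (201, 5195, 878), (202, 6059, 868), (203, 6923, 1012), (204, 7787, 1156), (205, 8659, 1300),
    (228, 865, 486), (229, 1729, 342), (230, 2593, 198), (231, 3457, 54), (234, 6049, 4),
    (235, 6913, 148), (236, 7777, 292), (259, 145, 615), (260, 1009, 479), (261, 1873, 335),
    (262, 2737, 191), (263, 3601, 47), (264, 4465, 35), (266, 6193, 17), (267, 7057, 161),
    (290, 161, 1455), (291, 297, 591), (292, 1161, 455), (293, 2025, 311), (296, 4617, 11),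
    (324, 1035, 434)])
    (by decide +kernel)

theorem hasCommonUnfolding_2_2_7_2_4_4 :
    HasCommonUnfolding {(2, 2, 7), (2, 4, 4)} :=
  hasCommonUnfolding_of_isCommonNetCode (L := [
    (42, 4355, 1300), (46, 5197, 2881), (74, 4331, 436), (78, 5221, 3025), (99, 868, 191),
    (105, 3457, 305), (106, 4321, 449), (107, 5185, 585), (108, 6064, 1449), (109, 6088, 2313),
    (110, 5237, 3177), (111, 4373, 3909), (131, 4, 167), (133, 145, 20), (134, 1009, 44),
    (137, 3601, 329), (138, 4465, 473), (139, 5329, 609), (140, 6208, 1473), (141, 6232, 2337),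
    (142, 5381, 3201), (143, 4517, 3933), (162, 13, 290), (163, 17, 146), (164, 161, 2),
    (165, 297, 8), (166, 1161, 32), (167, 2025, 48), (168, 2889, 192), (169, 3753, 336),
    (170, 4617, 480), (172, 5484, 1347), (173, 5508, 2211), (175, 4647, 3078), (194, 37, 1154),
    (195, 41, 1010), (196, 185, 866), (197, 321, 872), (198, 1185, 896), (199, 2049, 912),
    (200, 2913, 1056), (201, 3777, 1200), (225, 917, 2162), (226, 53, 2018), (229, 195, 1736),
    (230, 1059, 1760), (231, 1923, 1776), (232, 2787, 1920), (233, 3651, 2064),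
    (263, 1779, 2640), (264, 2643, 2784), (265, 3507, 2928), (294, 899, 2627), (295, 1763, 3499),
    (296, 2627, 3643), (297, 3491, 3787), (326, 875, 2603), (327, 1739, 3475), (328, 2603, 3619),
    (329, 3467, 3763), (359, 1729, 2596), (360, 2593, 2740), (391, 1873, 1732),
    (392, 2737, 1876)])
    (by decide +kernel)

theorem hasCommonUnfolding_1_1_16_3_3_4 :
    HasCommonUnfolding {(1, 1, 16), (3, 3, 4)} :=
  hasCommonUnfolding_of_isCommonNetCode (L := [
    (40, 7789, 2217), (41, 6925, 3081), (72, 7805, 2091), (73, 6941, 2955), (102, 9663, 219),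
    (103, 8799, 1083), (104, 7935, 1947), (105, 7071, 2811), (106, 6207, 3670),
    (107, 5343, 3646), (129, 12962, 1229), (131, 12103, 366), (134, 9511, 75), (135, 8647, 939),
    (136, 7783, 1803), (137, 6919, 2667), (138, 6055, 3526), (139, 5191, 3502),
    (141, 3463, 3475), (142, 2599, 3619), (144, 871, 3760), (145, 7, 3784), (146, 20, 3808),
    (161, 13845, 1359), (162, 12973, 495), (163, 12109, 359), (164, 11245, 215),
    (165, 10381, 71), (166, 9517, 59), (167, 8653, 923), (170, 6061, 2654), (171, 5197, 2630),
    (172, 4333, 2606), (173, 3469, 2596), (174, 2605, 2740), (175, 1741, 2884), (176, 877, 3036),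
    (177, 13, 3060), (194, 12989, 471), (195, 12125, 335), (196, 11261, 191), (197, 10397, 47),
    (198, 9533, 35), (199, 8669, 899), (202, 6077, 1790), (203, 5213, 1766), (204, 4349, 1742),
    (205, 3485, 1732), (206, 2621, 1876), (207, 1757, 2020), (208, 893, 2172), (209, 29, 2196),
    (226, 13119, 447), (227, 12255, 311), (228, 11391, 167), (229, 10527, 23), (236, 4479, 878),
    (237, 3615, 868), (238, 2751, 1012), (239, 1887, 1156), (240, 1023, 1308), (241, 159, 1332),
    (260, 11239, 146), (261, 10375, 2), (268, 4327, 14), (271, 1735, 292)])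
    (by decide +kernel)

/-- Area 70 is the first with four boxes, hence six pairs; areas 78 and 82 also have four. -/
theorem hasCommonUnfolding_1_1_17_1_2_11 :
    HasCommonUnfolding {(1, 1, 17), (1, 2, 11)} :=
  hasCommonUnfolding_of_isCommonNetCode (L := [
    (34, 1, 300), (66, 153, 164), (97, 20, 7), (98, 27, 20), (130, 11, 8), (131, 875, 24),
    (132, 1739, 168), (134, 3467, 146), (163, 865, 888), (164, 1729, 1032), (165, 2593, 1162),
    (166, 3457, 1010), (167, 4321, 866), (168, 5185, 872), (195, 1017, 1752), (196, 1881, 1896),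
    (197, 2745, 2026), (198, 3609, 1874), (199, 4473, 1730), (200, 5337, 1736), (227, 891, 2616),
    (228, 1755, 2760), (229, 2619, 2890), (230, 3483, 2738), (231, 4347, 2594),
    (232, 5211, 2600), (261, 2603, 3754), (263, 4331, 3458), (264, 5195, 3464),
    (265, 6059, 3480), (266, 6923, 3624), (268, 8651, 3602), (297, 6049, 4344),
    (298, 6913, 4488), (299, 7777, 4618), (300, 8641, 4466), (301, 9505, 4322),
    (302, 10369, 4328), (329, 6201, 5208), (330, 7065, 5352), (331, 7929, 5482),
    (332, 8793, 5330), (333, 9657, 5186), (334, 10521, 5192), (361, 6075, 6072),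
    (362, 6939, 6216), (363, 7803, 6346), (364, 8667, 6194), (365, 9531, 6050),
    (366, 10395, 6056), (395, 7787, 7210), (397, 9515, 6914), (398, 10379, 6920),
    (399, 11243, 6936), (400, 12107, 7080), (431, 11233, 7800), (432, 12097, 7944),
    (463, 11385, 8664), (464, 12249, 8808), (495, 11259, 9523), (496, 12123, 9667),
    (497, 12987, 8943), (498, 13851, 8079), (529, 12971, 8791), (530, 13835, 7927),
    (531, 14707, 7063), (561, 12961, 8647), (562, 13825, 7783), (593, 13113, 8653),
    (594, 13977, 7789)])
    (by decide +kernel)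

theorem hasCommonUnfolding_1_1_17_1_3_8 :
    HasCommonUnfolding {(1, 1, 17), (1, 3, 8)} :=
  hasCommonUnfolding_of_isCommonNetCode (L := [
    (33, 13, 2043), (34, 17, 2907), (66, 24, 2763), (67, 154, 3627), (68, 2, 4491),
    (99, 1018, 3483), (100, 866, 4347), (101, 872, 5211), (102, 888, 6075), (131, 1882, 3467),
    (132, 1730, 4331), (133, 1736, 5195), (134, 1752, 6059), (164, 2594, 4321),
    (165, 2600, 5185), (166, 2616, 6049), (167, 2746, 6928), (198, 3480, 6193),
    (199, 3610, 7072), (200, 3458, 6221), (201, 3464, 5357), (232, 4322, 6365),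
    (233, 4328, 5501), (234, 4344, 4637), (235, 4474, 3773), (264, 5186, 6495),
    (265, 5192, 5631), (266, 5208, 4767), (267, 5338, 3903), (295, 6202, 7222),
    (296, 6050, 6343), (297, 6056, 5479), (298, 6072, 4615), (329, 6920, 5335),
    (330, 6936, 4471), (331, 7066, 3607), (332, 6914, 2743), (363, 7930, 3463),
    (364, 7778, 2599), (365, 7784, 1735), (366, 7800, 871), (396, 8642, 2605), (397, 8648, 1741),
    (398, 8664, 877), (399, 8794, 13), (428, 9506, 2621), (429, 9512, 1757), (430, 9528, 893),
    (431, 9658, 29), (461, 10376, 1901), (462, 10392, 1037), (463, 10522, 173),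
    (464, 10370, 162), (494, 11256, 1181), (495, 11386, 317), (496, 11234, 306),
    (497, 11240, 289), (524, 12098, 3039), (525, 12104, 2175), (526, 12120, 1311),
    (527, 12250, 447), (555, 13114, 3751), (556, 12962, 2887), (557, 12968, 2023),
    (558, 12984, 1159), (589, 13832, 1879), (590, 13848, 1015), (591, 13978, 151),
    (623, 14710, 7), (624, 13831, 20)])
    (by decide +kernel)

theorem hasCommonUnfolding_1_1_17_1_5_5 :
    HasCommonUnfolding {(1, 1, 17), (1, 5, 5)} :=
  hasCommonUnfolding_of_isCommonNetCode (L := [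
    (34, 27, 1303), (35, 891, 439), (37, 2619, 459), (66, 11, 1159), (67, 875, 295),
    (68, 1739, 308), (69, 2603, 315), (70, 3467, 1179), (97, 18, 1879), (98, 1, 1015),
    (99, 865, 151), (100, 1729, 164), (101, 2593, 171), (102, 3457, 1035), (103, 4321, 1899),
    (130, 153, 871), (131, 1017, 7), (132, 1881, 20), (133, 2745, 27), (134, 3609, 891),
    (135, 4473, 1755), (136, 5337, 2619), (137, 6201, 3483), (164, 1755, 8), (166, 3483, 875),
    (167, 4347, 1739), (168, 5211, 2603), (169, 6075, 3467), (199, 4331, 1729),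
    (200, 5195, 2593), (201, 6059, 3457), (202, 6923, 4336), (232, 5185, 2737),
    (233, 6049, 3601), (234, 6913, 4480), (235, 7777, 3629), (236, 8641, 2765),
    (266, 7065, 4624), (267, 7929, 3773), (268, 8793, 2909), (269, 9657, 2045),
    (275, 12984, 2017), (276, 13114, 2881), (298, 6939, 4768), (299, 7803, 3917),
    (300, 8667, 3053), (301, 9531, 2189), (302, 10395, 1325), (304, 12123, 450),
    (307, 13848, 2161), (311, 11261, 3026), (331, 7787, 4061), (332, 8651, 3197),
    (333, 9515, 2333), (334, 10379, 1469), (335, 11243, 605), (336, 12107, 594),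
    (337, 12971, 577), (338, 13835, 1441), (339, 14707, 2305), (340, 13983, 3169),
    (342, 12255, 4034), (343, 11391, 3890), (344, 10527, 3746), (365, 9505, 2463),
    (366, 10369, 1599), (367, 11233, 735), (372, 13831, 3321), (373, 12967, 4185),
    (374, 12103, 4917)])
    (by decide +kernel)

theorem hasCommonUnfolding_1_2_11_1_3_8 :
    HasCommonUnfolding {(1, 2, 11), (1, 3, 8)} :=
  hasCommonUnfolding_of_isCommonNetCode (L := [
    (35, 171, 1182), (67, 27, 318), (68, 891, 174), (97, 167, 1311), (98, 23, 447),
    (99, 11, 311), (129, 146, 1159), (130, 2, 295), (134, 298, 2043), (161, 1010, 1015),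
    (162, 866, 151), (163, 872, 164), (165, 1032, 1035), (166, 1162, 1899), (195, 1736, 20),
    (196, 1752, 27), (197, 1896, 891), (198, 2026, 1755), (199, 1874, 2619), (200, 1730, 3483),
    (228, 2616, 11), (229, 2760, 875), (230, 2890, 1739), (231, 2738, 2603), (232, 2594, 3467),
    (233, 2600, 4331), (260, 3480, 1), (261, 3624, 865), (262, 3754, 1729), (263, 3602, 2593),
    (264, 3458, 3457), (265, 3464, 4321), (294, 4618, 1873), (295, 4466, 2737),
    (296, 4322, 3601), (297, 4328, 4465), (298, 4344, 5329), (299, 4488, 6193),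
    (326, 5482, 2017), (327, 5330, 2881), (328, 5186, 3745), (329, 5192, 4609),
    (330, 5208, 5473), (331, 5352, 6337), (358, 6346, 2169), (359, 6194, 3033),
    (360, 6050, 3897), (361, 6056, 4761), (362, 6072, 5625), (363, 6216, 6489),
    (391, 7058, 2907), (392, 6914, 3771), (393, 6920, 4635), (394, 6936, 5499),
    (395, 7080, 6363), (396, 7210, 7222), (423, 7922, 2763), (424, 7778, 3627),
    (425, 7784, 4491), (426, 7800, 5355), (427, 7944, 6219), (428, 8074, 7078),
    (457, 8648, 4347), (458, 8664, 5211), (459, 8808, 6075), (460, 8938, 6934),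
    (490, 9523, 5195), (492, 9670, 6062), (493, 8791, 6052), (525, 8647, 5188)])
    (by decide +kernel)

theorem hasCommonUnfolding_1_2_11_1_5_5 :
    HasCommonUnfolding {(1, 2, 11), (1, 5, 5)} :=
  hasCommonUnfolding_of_isCommonNetCode (L := [
    (39, 297, 4185), (71, 171, 4059), (103, 27, 3915), (133, 167, 2043), (134, 23, 2907),
    (135, 11, 3771), (136, 875, 4630), (165, 146, 1899), (166, 2, 2763), (196, 1162, 891),
    (197, 1010, 1755), (198, 866, 2619), (200, 888, 3480), (201, 1032, 3624), (227, 1896, 11),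
    (228, 2026, 875), (229, 1874, 1739), (230, 1730, 2603), (231, 1736, 3467), (232, 1752, 4339),
    (258, 2616, 18), (259, 2760, 1), (260, 2890, 865), (261, 2738, 1729), (262, 2594, 2593),
    (263, 2600, 3457), (291, 3624, 145), (292, 3754, 1009), (293, 3602, 1873), (294, 3458, 2737),
    (295, 3464, 3601), (296, 3480, 4480), (322, 4344, 306), (323, 4488, 289), (324, 4618, 1153),
    (325, 4466, 2017), (326, 4322, 2881), (327, 4328, 3745), (355, 5352, 433), (356, 5482, 1297),
    (357, 5330, 2161), (358, 5186, 3025), (359, 5192, 3889), (360, 5208, 4768), (387, 6216, 577),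
    (388, 6346, 1441), (389, 6194, 2305), (390, 6050, 3169), (391, 6056, 4033),
    (392, 6072, 4912), (417, 6920, 449), (418, 6936, 593), (419, 7080, 729), (420, 7210, 1593),
    (421, 7058, 2457), (422, 6914, 3321), (449, 7784, 456), (451, 7944, 603), (452, 8074, 1467),
    (453, 7922, 2331), (454, 7778, 3195), (484, 8938, 1323), (485, 8786, 2187),
    (486, 8642, 3051), (515, 8811, 315), (516, 9670, 1179), (546, 7803, 164), (547, 8667, 171),
    (548, 9526, 1035), (579, 8651, 27)])
    (by decide +kernel)

theorem hasCommonUnfolding_1_3_8_1_5_5 :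
    HasCommonUnfolding {(1, 3, 8), (1, 5, 5)} :=
  hasCommonUnfolding_of_isCommonNetCode (L := [
    (40, 1758, 3051), (72, 894, 2907), (73, 878, 3771), (102, 318, 1035), (103, 174, 1899),
    (104, 30, 2763), (105, 14, 3627), (134, 311, 891), (135, 167, 1755), (136, 23, 2619),
    (165, 442, 11), (166, 290, 875), (167, 146, 1739), (168, 2, 2603), (195, 1032, 29),
    (196, 1176, 18), (197, 1306, 1), (198, 1154, 865), (199, 1010, 1729), (200, 866, 2593),
    (227, 1896, 173), (228, 2040, 162), (229, 2170, 145), (230, 2018, 1009), (231, 1874, 1873),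
    (232, 1730, 2737), (233, 1736, 3601), (257, 2600, 2045), (258, 2616, 1181), (259, 2760, 317),
    (260, 2904, 306), (261, 3034, 289), (262, 2882, 1153), (263, 2738, 2017), (264, 2594, 2881),
    (290, 3480, 1325), (291, 3624, 461), (292, 3768, 450), (293, 3898, 433), (294, 3746, 1297),
    (295, 3602, 2161), (296, 3458, 3025), (297, 3464, 3889), (322, 4344, 1469), (323, 4488, 605),
    (324, 4632, 594), (325, 4762, 577), (326, 4610, 1441), (327, 4466, 2305), (328, 4322, 3169),
    (329, 4328, 4033), (356, 5496, 730), (358, 5474, 1593), (359, 5330, 2457), (360, 5186, 3321),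
    (361, 5192, 4185), (362, 5208, 4917), (391, 6194, 2331), (392, 6050, 3195),
    (393, 6056, 4059), (423, 7077, 2187), (425, 6928, 3915), (426, 6077, 4774),
    (458, 6221, 4630), (459, 5357, 3751), (490, 6365, 4486), (521, 7219, 3483),
    (522, 6495, 4342), (523, 5631, 3463), (553, 6340, 3467)])
    (by decide +kernel)

theorem hasCommonUnfolding_2_2_8_2_3_6 :
    HasCommonUnfolding {(2, 2, 8), (2, 3, 6)} :=
  hasCommonUnfolding_of_isCommonNetCode (L := [
    (41, 4328, 3457), (42, 4352, 4321), (43, 4368, 5200), (44, 4512, 5224), (45, 4642, 4373),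
    (46, 4618, 3509), (74, 5216, 4465), (75, 5232, 5344), (76, 5376, 5368), (77, 5506, 4517),
    (78, 5482, 3653), (107, 6096, 5488), (108, 6240, 5512), (134, 2627, 4358), (135, 3491, 4334),
    (138, 6083, 4612), (139, 6955, 4764), (140, 7099, 4788), (141, 6375, 4662),
    (167, 3467, 3470), (169, 5195, 3604), (170, 6059, 3748), (171, 6931, 3900),
    (172, 7075, 3924), (173, 6351, 3798), (199, 3457, 2606), (200, 4321, 2596),
    (201, 5185, 2740), (203, 6052, 3036), (205, 6199, 2934), (230, 2737, 1766),
    (231, 3601, 1742), (232, 4465, 1732), (233, 5329, 1876), (262, 2889, 902), (263, 3753, 878),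
    (289, 300, 3493), (290, 324, 2629), (294, 2913, 38), (295, 3777, 14), (322, 188, 2645),
    (323, 195, 1781), (324, 1059, 917), (325, 1923, 53), (326, 2787, 42), (327, 3651, 18),
    (354, 44, 2789), (355, 51, 1925), (356, 915, 1061), (357, 1779, 197), (358, 2643, 186),
    (359, 3507, 162), (387, 35, 2069), (388, 899, 1205), (389, 1763, 341), (418, 23, 3063),
    (419, 11, 2199), (420, 875, 1335), (421, 1739, 471), (422, 2603, 335), (451, 1, 2175),
    (452, 865, 1311), (453, 1729, 447), (454, 2593, 311), (482, 162, 2887), (483, 145, 2023),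
    (484, 1009, 1159), (485, 1873, 295), (516, 1161, 1015), (517, 2025, 151), (548, 1185, 871),
    (549, 2049, 7)])
    (by decide +kernel)

theorem hasCommonUnfolding_1_2_12_2_4_5 :
    HasCommonUnfolding {(1, 2, 12), (2, 4, 5)} :=
  hasCommonUnfolding_of_isCommonNetCode (L := [
    (44, 10533, 3075), (45, 10389, 3939), (73, 9508, 339), (74, 9652, 1203), (75, 9804, 2067),
    (76, 9678, 2931), (77, 9534, 3795), (78, 9518, 4654), (105, 8644, 195), (106, 8788, 1059),
    (107, 8940, 1923), (108, 8814, 2787), (109, 8670, 3651), (110, 8654, 4510), (137, 7780, 51),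
    (138, 7924, 915), (139, 8076, 1779), (140, 7950, 2643), (141, 7806, 3507), (142, 7790, 4366),
    (168, 6926, 47), (169, 6916, 35), (170, 7060, 899), (171, 7212, 1763), (172, 7086, 2627),
    (173, 6942, 3491), (200, 6062, 23), (201, 6052, 11), (202, 6196, 875), (203, 6348, 1739),
    (204, 6222, 2603), (205, 6078, 3467), (233, 5188, 1), (234, 5332, 865), (235, 5484, 1729),
    (236, 5358, 2593), (237, 5214, 3457), (238, 5198, 4336), (263, 4350, 186), (264, 4334, 162),
    (265, 4324, 145), (266, 4468, 1009), (267, 4620, 1873), (268, 4494, 2737), (295, 3486, 330),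
    (296, 3470, 306), (297, 3460, 289), (298, 3604, 1153), (299, 3756, 2017), (300, 3630, 2881),
    (324, 2740, 2213), (325, 2892, 1349), (326, 2766, 485), (327, 2622, 474), (328, 2606, 450),
    (329, 2596, 433), (353, 1758, 4795), (354, 1742, 4071), (355, 1732, 3207), (356, 1876, 2343),
    (357, 2028, 1479), (358, 1902, 615), (385, 894, 4771), (386, 878, 4047), (387, 868, 3183),
    (388, 1012, 2319), (389, 1164, 1455), (390, 1038, 591), (418, 14, 3895), (419, 4, 3031),
    (420, 148, 2167), (421, 300, 1303), (449, 29, 4630), (450, 18, 3751), (481, 173, 4486),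
    (482, 162, 3607)])
    (by decide +kernel)

theorem hasCommonUnfolding_1_1_19_1_3_9 :
    HasCommonUnfolding {(1, 1, 19), (1, 3, 9)} :=
  hasCommonUnfolding_of_isCommonNetCode (L := [
    (38, 1729, 4), (65, 868, 447), (66, 1020, 311), (70, 1881, 17), (71, 2745, 161),
    (98, 156, 290), (99, 30, 146), (101, 891, 8), (102, 1755, 24), (103, 2619, 168),
    (104, 3483, 312), (131, 23, 1010), (132, 11, 866), (133, 875, 872), (134, 1739, 888),
    (135, 2603, 1032), (136, 3467, 1176), (137, 4331, 1306), (164, 1, 1730), (167, 2593, 1896),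
    (168, 3457, 2040), (169, 4321, 2170), (200, 3609, 2904), (201, 4473, 3034),
    (202, 5337, 2882), (233, 4347, 3898), (234, 5211, 3746), (235, 6075, 3602),
    (266, 5195, 4610), (267, 6059, 4466), (268, 6923, 4322), (269, 7787, 4328),
    (298, 5185, 5474), (299, 6049, 5330), (300, 6913, 5186), (301, 7777, 5192),
    (302, 8641, 5208), (331, 6201, 6194), (332, 7065, 6050), (333, 7929, 6056),
    (334, 8793, 6072), (335, 9657, 6216), (364, 6939, 6914), (365, 7803, 6920),
    (366, 8667, 6936), (367, 9531, 7080), (368, 10395, 7224), (398, 8651, 7795),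
    (399, 9515, 7939), (400, 10379, 8083), (431, 9505, 7060), (432, 10369, 7204),
    (433, 11233, 7356), (464, 10521, 6340), (465, 11385, 6492), (466, 12249, 6366),
    (497, 11259, 5628), (498, 12123, 5502), (499, 12987, 5358), (529, 11243, 4764),
    (530, 12107, 4638), (531, 12971, 4494), (532, 13835, 4350), (562, 12097, 3774),
    (563, 12961, 3630), (564, 13825, 3486), (565, 14689, 3470), (566, 15553, 3460),
    (595, 13113, 2766), (596, 13977, 2622), (597, 14841, 2606), (598, 15705, 2596),
    (599, 16437, 2740), (628, 13851, 1758), (629, 14715, 1742), (631, 15582, 1876),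
    (632, 15566, 2020), (664, 14702, 1156)])
    (by decide +kernel)

theorem hasCommonUnfolding_1_1_19_1_4_7 :
    HasCommonUnfolding {(1, 1, 19), (1, 4, 7)} :=
  hasCommonUnfolding_of_isCommonNetCode (L := [
    (52, 13977, 161), (56, 15711, 455), (57, 14847, 311), (65, 1020, 2599), (66, 894, 1735),
    (67, 878, 871), (84, 13851, 168), (85, 14715, 312), (86, 15579, 456), (87, 16438, 586),
    (88, 15559, 434), (98, 30, 1741), (99, 14, 877), (102, 1739, 11), (117, 14699, 1176),
    (118, 15563, 1320), (131, 18, 893), (132, 1, 29), (133, 865, 18), (134, 1729, 1),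
    (144, 10369, 1874), (147, 12961, 1752), (148, 13825, 1896), (149, 14689, 2040),
    (163, 154, 1037), (166, 1881, 145), (167, 2745, 1009), (174, 8793, 3026), (175, 9657, 2882),
    (176, 10521, 2738), (178, 12249, 2600), (179, 13113, 2616), (198, 1755, 289),
    (199, 2619, 1153), (200, 3483, 2017), (206, 8667, 3890), (207, 9531, 3746),
    (208, 10395, 3602), (209, 11259, 3458), (210, 12123, 3464), (211, 12987, 3480),
    (231, 2603, 1297), (232, 3467, 2161), (235, 6059, 4753), (239, 9515, 4610),
    (240, 10379, 4466), (241, 11243, 4322), (242, 12107, 4328), (243, 12971, 4344),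
    (244, 13835, 4488), (263, 2593, 1449), (264, 3457, 2313), (265, 4321, 3177),
    (266, 5185, 4041), (267, 6049, 4905), (269, 7777, 5770), (270, 8641, 5618),
    (271, 9505, 5474), (273, 11233, 5186), (274, 12097, 5192), (296, 3609, 2187),
    (297, 4473, 3051), (298, 5337, 3915), (299, 6201, 4779), (300, 7065, 5643),
    (301, 7929, 6502), (305, 11385, 6069), (329, 4347, 2907), (330, 5211, 3771),
    (331, 6075, 4635), (332, 6939, 5499), (333, 7803, 6358), (361, 4331, 2763),
    (362, 5195, 3627), (364, 6923, 5355), (365, 7787, 6214), (366, 8651, 5335),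
    (396, 6913, 5211)])
    (by decide +kernel)

theorem hasCommonUnfolding_1_1_19_3_3_5 :
    HasCommonUnfolding {(1, 1, 19), (3, 3, 5)} :=
  hasCommonUnfolding_of_isCommonNetCode (L := [
    (40, 3457, 3821), (45, 7777, 366), (53, 14689, 2217), (54, 15553, 3081), (69, 1017, 4387),
    (70, 1881, 4531), (71, 2745, 4675), (72, 3609, 3951), (75, 6201, 1359), (76, 7065, 495),
    (77, 7929, 359), (84, 13977, 1227), (85, 14841, 2091), (86, 15705, 2955), (102, 1755, 4507),
    (103, 2619, 4651), (104, 3483, 3927), (105, 4347, 3063), (106, 5211, 2199),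
    (107, 6075, 1335), (108, 6939, 471), (109, 7803, 335), (110, 8667, 191), (114, 12123, 212),
    (115, 12987, 219), (116, 13851, 1083), (117, 14715, 1947), (118, 15579, 2811),
    (119, 16438, 3675), (134, 1739, 4483), (135, 2603, 4627), (136, 3467, 3903),
    (137, 4331, 3039), (138, 5195, 2175), (139, 6059, 1311), (140, 6923, 447), (141, 7787, 311),
    (142, 8651, 167), (144, 10379, 20), (145, 11243, 44), (146, 12107, 68), (147, 12971, 75),
    (151, 15566, 3531), (164, 1, 3470), (165, 865, 3460), (166, 1729, 3604), (167, 2593, 3748),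
    (169, 4321, 2887), (170, 5185, 2023), (171, 6049, 1159), (172, 6913, 295), (174, 8641, 146),
    (175, 9505, 2), (176, 10369, 8), (177, 11233, 32), (178, 12097, 56), (183, 14702, 3515),
    (193, 877, 2670), (194, 13, 2654), (195, 17, 2630), (196, 153, 2606), (201, 4473, 2743),
    (202, 5337, 1879), (206, 8793, 1010), (207, 9657, 866), (208, 10521, 872), (209, 11385, 896),
    (210, 12249, 920), (211, 13113, 936), (215, 13838, 3491), (216, 13828, 4363),
    (225, 893, 1806), (226, 29, 1790), (239, 9531, 1730), (240, 10395, 1736), (241, 11259, 1760),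
    (248, 12964, 4339), (271, 9515, 2594)])
    (by decide +kernel)

theorem hasCommonUnfolding_1_3_9_1_4_7 :
    HasCommonUnfolding {(1, 3, 9), (1, 4, 7)} :=
  hasCommonUnfolding_of_isCommonNetCode (L := [
    (36, 5502, 865), (67, 4764, 145), (68, 4638, 1009), (69, 4494, 1873), (100, 3774, 1153),
    (131, 3036, 433), (132, 2910, 1297), (162, 2020, 449), (163, 2172, 585), (164, 2046, 1449),
    (195, 1308, 459), (196, 1182, 1323), (197, 1038, 2187), (225, 148, 295), (226, 292, 308),
    (227, 444, 315), (228, 318, 1179), (229, 174, 2043), (259, 308, 171), (291, 164, 27),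
    (294, 1899, 2619), (295, 2763, 3483), (296, 3627, 4347), (323, 20, 11), (324, 27, 875),
    (325, 891, 1739), (326, 1755, 2603), (327, 2619, 3467), (328, 3483, 4331), (354, 2, 18),
    (355, 8, 1), (357, 875, 1729), (358, 1739, 2593), (359, 2603, 3457), (360, 3467, 4321),
    (361, 4331, 5185), (386, 866, 162), (390, 1729, 2737), (391, 2593, 3601), (392, 3457, 4465),
    (393, 4321, 5329), (394, 5185, 6208), (421, 1009, 2017), (422, 1873, 2881),
    (423, 2737, 3745), (424, 3601, 4609), (425, 4465, 5473), (426, 5329, 6352),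
    (427, 6193, 5501), (453, 1153, 2161), (455, 2881, 3889), (456, 3745, 4753),
    (457, 4609, 5617), (458, 5473, 6496), (462, 6338, 6069), (488, 3897, 4905),
    (490, 5625, 5772), (491, 6489, 5646), (493, 7354, 5358), (494, 7202, 5214),
    (495, 7058, 5198), (523, 6363, 4782), (524, 7227, 4638), (525, 8086, 4494),
    (554, 5355, 4044), (555, 6219, 3918), (556, 7083, 3774), (557, 7942, 3630),
    (585, 4347, 3028), (586, 5211, 3180), (587, 6075, 3054), (588, 6939, 2910),
    (589, 7798, 2766), (618, 5195, 2316), (621, 6926, 1902), (622, 6916, 1758),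
    (653, 6062, 1038), (654, 6052, 894)])
    (by decide +kernel)

theorem hasCommonUnfolding_1_3_9_3_3_5 :
    HasCommonUnfolding {(1, 3, 9), (3, 3, 5)} :=
  hasCommonUnfolding_of_isCommonNetCode (L := [
    (40, 3457, 3060), (70, 1873, 2020), (71, 2737, 2172), (72, 3601, 2196), (73, 4465, 2220),
    (99, 1308, 151), (102, 2017, 1156), (103, 2881, 1308), (104, 3745, 1332), (105, 4609, 1356),
    (131, 444, 7), (134, 2169, 292), (135, 3033, 444), (136, 3897, 468), (137, 4761, 492),
    (141, 7354, 3081), (143, 6495, 3946), (144, 5631, 3922), (161, 1159, 1741), (162, 295, 877),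
    (163, 308, 13), (164, 315, 17), (165, 1179, 161), (166, 2043, 305), (169, 4635, 356),
    (170, 5499, 363), (171, 6363, 1227), (172, 7227, 2091), (173, 8086, 2955), (174, 7207, 3819),
    (175, 6343, 4678), (176, 5479, 4654), (193, 1015, 1765), (194, 151, 901), (195, 164, 37),
    (196, 171, 41), (197, 1035, 185), (198, 1899, 329), (201, 4491, 212), (202, 5355, 219),
    (203, 6219, 1083), (204, 7083, 1947), (205, 7942, 2811), (206, 7063, 3675),
    (207, 6199, 4534), (208, 5335, 4510), (225, 871, 1789), (226, 7, 925), (227, 20, 61),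
    (228, 27, 65), (235, 6075, 939), (236, 6939, 1803), (237, 7798, 2667), (238, 6919, 3531),
    (239, 6055, 4390), (240, 5191, 4366), (241, 4327, 4342), (243, 2599, 4483),
    (244, 1735, 4627), (260, 11, 72), (269, 6926, 2651), (271, 6061, 3518), (272, 5197, 3494),
    (273, 4333, 3470), (274, 3469, 3460), (275, 2605, 3604), (276, 1741, 3748), (277, 877, 3900),
    (304, 5213, 2630), (305, 4349, 2606), (306, 3485, 2596), (307, 2621, 2740),
    (308, 1757, 2884), (309, 893, 3036), (338, 3629, 1732), (339, 2765, 1876), (370, 3773, 868),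
    (371, 2909, 1012)])
    (by decide +kernel)

theorem hasCommonUnfolding_1_4_7_3_3_5 :
    HasCommonUnfolding {(1, 4, 7), (3, 3, 5)} :=
  hasCommonUnfolding_of_isCommonNetCode (L := [
    (41, 5191, 1876), (73, 5197, 1012), (74, 4333, 1156), (75, 3469, 1308), (105, 5213, 148),
    (106, 4349, 292), (138, 4493, 305), (139, 3629, 441), (141, 1901, 2169), (143, 173, 3897),
    (144, 162, 4629), (165, 5352, 164), (166, 5496, 188), (170, 4637, 329), (171, 3773, 465),
    (172, 2909, 1329), (173, 2045, 2193), (174, 1181, 3057), (175, 317, 3921), (196, 6067, 7),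
    (197, 6211, 20), (198, 6355, 44), (200, 6496, 65), (201, 5645, 209), (202, 4781, 353),
    (203, 3917, 489), (204, 3053, 1353), (205, 2189, 2217), (206, 1325, 3081), (207, 461, 3945),
    (229, 5332, 8), (230, 5476, 32), (231, 5620, 56), (232, 5772, 72), (235, 4047, 363),
    (236, 3183, 1227), (237, 2319, 2091), (238, 1455, 2955), (239, 591, 3819), (260, 4324, 866),
    (261, 4468, 872), (262, 4612, 896), (263, 4756, 920), (264, 4908, 936), (267, 3895, 219),
    (268, 3031, 1083), (269, 2167, 1947), (270, 1303, 2811), (271, 439, 3675), (272, 452, 4534),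
    (290, 3486, 2018), (292, 3460, 1730), (293, 3604, 1736), (294, 3748, 1760),
    (301, 2023, 1803), (302, 1159, 2667), (303, 295, 3531), (304, 308, 4390), (321, 2766, 3034),
    (322, 2622, 2882), (323, 2606, 2738), (324, 2596, 2594), (325, 2740, 2600),
    (326, 2884, 2624), (333, 1879, 1787), (334, 1015, 2651), (335, 151, 3515), (338, 1035, 4675),
    (354, 1758, 3746), (355, 1742, 3602), (356, 1732, 3458), (367, 7, 3491), (368, 20, 4363),
    (369, 27, 4507), (370, 891, 4651), (387, 878, 4485), (388, 868, 4341), (399, 13, 3467)])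
    (by decide +kernel)

theorem hasCommonUnfolding_2_2_9_3_4_4 :
    HasCommonUnfolding {(2, 2, 9), (3, 4, 4)} :=
  hasCommonUnfolding_of_isCommonNetCode (L := [
    (40, 303, 3664), (41, 167, 2813), (42, 23, 1949), (45, 41, 210), (46, 185, 186),
    (73, 146, 2957), (74, 2, 2093), (75, 8, 1229), (76, 32, 365), (77, 48, 354), (78, 192, 330),
    (79, 322, 306), (105, 1010, 3101), (106, 866, 2237), (107, 872, 1373), (108, 896, 509),
    (109, 912, 498), (110, 1056, 474), (111, 1186, 450), (112, 1162, 433), (133, 1776, 3523),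
    (135, 2050, 3811), (136, 2026, 3955), (137, 1874, 3231), (138, 1730, 2367),
    (139, 1736, 1503), (140, 1760, 639), (142, 1920, 610), (164, 2624, 2627), (165, 2640, 3499),
    (166, 2784, 3643), (167, 2914, 3787), (168, 2890, 3931), (169, 2738, 3207),
    (170, 2594, 2343), (171, 2600, 1479), (197, 3504, 3475), (198, 3648, 3619),
    (199, 3778, 3763), (200, 3754, 3907), (201, 3602, 3183), (202, 3458, 2319),
    (203, 3464, 1455), (204, 3488, 591), (228, 4352, 2606), (229, 4368, 2596), (230, 4512, 2740),
    (231, 4642, 2884), (232, 4618, 3028), (235, 4328, 1303), (259, 5192, 1766),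
    (260, 5216, 1742), (261, 5232, 1732), (262, 5376, 1876), (263, 5506, 2020),
    (264, 5482, 2164), (292, 6080, 878), (293, 6096, 868), (294, 6240, 1012), (295, 6370, 1156),
    (325, 6960, 4), (326, 7104, 148), (327, 7234, 292), (356, 6947, 13), (357, 7819, 17),
    (358, 7963, 161), (387, 6059, 901), (388, 6923, 37), (389, 7795, 41), (417, 4321, 2653),
    (418, 5185, 1789), (419, 6049, 925), (420, 6913, 61), (449, 4465, 2669), (450, 5329, 1805),
    (451, 6193, 941), (452, 7057, 77), (453, 7936, 66), (483, 6345, 1085), (484, 7209, 221)])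
    (by decide +kernel)

theorem hasCommonUnfolding_1_1_20_1_2_13 :
    HasCommonUnfolding {(1, 1, 20), (1, 2, 13)} :=
  hasCommonUnfolding_of_isCommonNetCode (L := [
    (34, 16423, 174), (65, 17301, 303), (66, 16429, 167), (67, 15565, 23), (98, 16445, 146),
    (99, 15581, 2), (100, 14717, 8), (101, 13853, 24), (130, 16575, 1010), (131, 15711, 866),
    (132, 14847, 872), (133, 13983, 888), (134, 13119, 1032), (135, 12255, 1162),
    (163, 15559, 1730), (164, 14695, 1736), (165, 13831, 1752), (166, 12967, 1896),
    (167, 12103, 2026), (168, 11239, 1874), (196, 14701, 2600), (197, 13837, 2616),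
    (198, 12973, 2760), (199, 12109, 2890), (200, 11245, 2738), (201, 10381, 2594),
    (230, 12989, 3624), (231, 12125, 3754), (232, 11261, 3602), (233, 10397, 3458),
    (234, 9533, 3464), (235, 8669, 3480), (264, 11391, 4466), (265, 10527, 4322),
    (266, 9663, 4328), (267, 8799, 4344), (268, 7935, 4488), (269, 7071, 4618),
    (297, 10375, 5186), (298, 9511, 5192), (299, 8647, 5208), (300, 7783, 5352),
    (301, 6919, 5482), (302, 6055, 5330), (330, 9517, 6056), (331, 8653, 6072),
    (332, 7789, 6216), (333, 6925, 6346), (334, 6061, 6194), (335, 5197, 6050),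
    (364, 7805, 7080), (365, 6941, 7210), (366, 6077, 7058), (367, 5213, 6914),
    (368, 4349, 6920), (369, 3485, 6936), (398, 6207, 7922), (399, 5343, 7778),
    (400, 4479, 7784), (401, 3615, 7800), (402, 2751, 7944), (403, 1887, 8074),
    (431, 5191, 8642), (432, 4327, 8648), (433, 3463, 8664), (434, 2599, 8808),
    (435, 1735, 8938), (436, 871, 8786), (464, 4333, 9512), (465, 3469, 9528), (466, 2605, 9672),
    (467, 1741, 9802), (468, 877, 9650), (469, 13, 9506), (498, 2621, 10536), (499, 1757, 10666),
    (500, 893, 10514), (501, 29, 10370), (502, 18, 10376), (503, 1, 10392), (532, 1023, 11397),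
    (533, 159, 11253)])
    (by decide +kernel)

theorem hasCommonUnfolding_1_1_20_1_5_6 :
    HasCommonUnfolding {(1, 1, 20), (1, 5, 6)} :=
  hasCommonUnfolding_of_isCommonNetCode (L := [
    (37, 15711, 4898), (38, 14847, 4754), (39, 13983, 4610), (67, 17302, 4185),
    (68, 16423, 5049), (69, 15559, 5781), (70, 14695, 5637), (71, 13831, 5493),
    (72, 12967, 5349), (74, 11239, 5206), (97, 16572, 2331), (98, 16446, 3195),
    (99, 16430, 4059), (101, 15565, 4926), (102, 14701, 4782), (103, 13837, 4638),
    (104, 12973, 4494), (105, 12109, 4350), (106, 11245, 4334), (107, 10381, 4324),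
    (108, 9517, 4468), (130, 15582, 3051), (134, 14717, 3918), (135, 13853, 3774),
    (136, 12989, 3630), (137, 12125, 3486), (138, 11261, 3470), (139, 10397, 3460),
    (140, 9533, 3604), (141, 8669, 3748), (142, 7805, 3892), (143, 6941, 4036),
    (168, 13119, 2766), (169, 12255, 2622), (170, 11391, 2606), (171, 10527, 2596),
    (172, 9663, 2740), (173, 8799, 2884), (174, 7935, 3028), (175, 7071, 3172),
    (176, 6207, 3324), (201, 12103, 1758), (203, 10375, 1732), (204, 9511, 1876),
    (205, 8647, 2020), (206, 7783, 2164), (207, 6919, 2308), (208, 6055, 2460),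
    (237, 8653, 1156), (238, 7789, 1300), (239, 6925, 1444), (240, 6061, 1596),
    (241, 5197, 1470), (242, 4333, 1326), (243, 3469, 1182), (272, 6077, 732), (273, 5213, 606),
    (274, 4349, 462), (275, 3485, 318), (276, 2621, 174), (277, 1757, 30), (305, 5343, 599),
    (306, 4479, 455), (307, 3615, 311), (308, 2751, 167), (309, 1887, 23), (337, 5191, 578),
    (338, 4327, 434), (339, 3463, 290), (340, 2599, 146), (341, 1735, 2), (342, 871, 8),
    (372, 2605, 1010), (373, 1741, 866), (374, 877, 872), (375, 13, 888), (376, 17, 1032),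
    (406, 893, 1736), (408, 24, 1896), (409, 154, 2040), (410, 2, 2184), (441, 1018, 2904)])
    (by decide +kernel)

theorem hasCommonUnfolding_1_1_20_2_3_7 :
    HasCommonUnfolding {(1, 1, 20), (2, 3, 7)} :=
  hasCommonUnfolding_of_isCommonNetCode (L := [
    (37, 14701, 465), (53, 877, 162), (56, 11, 1873), (68, 15581, 332), (69, 14717, 339),
    (85, 893, 306), (86, 29, 289), (87, 18, 1153), (88, 1, 2017), (100, 15711, 188),
    (101, 14847, 195), (117, 1023, 442), (120, 153, 2169), (131, 16423, 20), (132, 15559, 44),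
    (133, 14695, 51), (134, 13831, 915), (135, 12967, 1779), (146, 3463, 1056),
    (147, 2599, 1200), (148, 1735, 1330), (149, 871, 1306), (161, 16569, 146), (162, 17301, 2),
    (163, 16429, 8), (164, 15565, 32), (166, 13837, 899), (167, 12973, 1763), (178, 3469, 1920),
    (179, 2605, 2064), (180, 1741, 2194), (193, 16443, 1010), (198, 13853, 875),
    (199, 12989, 1739), (207, 6077, 2600), (208, 5213, 2624), (209, 4349, 2640),
    (210, 3485, 2784), (211, 2621, 2928), (212, 1757, 3058), (230, 13983, 865),
    (231, 13119, 1729), (232, 12255, 2593), (233, 11391, 3457), (239, 6207, 3464),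
    (240, 5343, 3488), (241, 4479, 3504), (242, 3615, 3648), (243, 2751, 3792),
    (244, 1887, 3922), (264, 12103, 2737), (265, 11239, 3601), (266, 10375, 4465),
    (267, 9511, 5329), (270, 6919, 4322), (271, 6055, 4328), (272, 5191, 4352),
    (273, 4327, 4368), (296, 12109, 2881), (297, 11245, 3745), (298, 10381, 4609),
    (299, 9517, 5473), (302, 6925, 5186), (303, 6061, 5192), (304, 5197, 5216),
    (305, 4333, 5232), (328, 12125, 3033), (329, 11261, 3897), (330, 10397, 4761),
    (331, 9533, 5625), (332, 8669, 6357), (333, 7805, 6213), (334, 6941, 6069),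
    (362, 10527, 4785), (363, 9663, 5649), (364, 8799, 6381), (365, 7935, 6237),
    (366, 7071, 6093), (396, 8647, 5526), (397, 7783, 5382), (428, 8653, 4662),
    (429, 7789, 4518)])
    (by decide +kernel)

theorem hasCommonUnfolding_1_2_13_1_5_6 :
    HasCommonUnfolding {(1, 2, 13), (1, 5, 6)} :=
  hasCommonUnfolding_of_isCommonNetCode (L := [
    (34, 10375, 4034), (66, 10381, 4898), (72, 5197, 4344), (73, 4333, 4488), (97, 11248, 5049),
    (98, 10397, 5781), (99, 9533, 5637), (104, 5213, 5203), (105, 4349, 5347), (106, 3485, 5491),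
    (130, 10541, 4926), (131, 9677, 4782), (132, 8813, 4638), (135, 6221, 4334),
    (136, 5357, 4324), (137, 4493, 4468), (138, 3629, 4612), (139, 2765, 4756),
    (161, 11395, 4188), (162, 10671, 4062), (163, 9807, 3918), (164, 8943, 3774),
    (165, 8079, 3630), (166, 7215, 3486), (167, 6351, 3470), (168, 5487, 3460),
    (169, 4623, 3604), (170, 3759, 3748), (171, 2895, 3892), (194, 10519, 3198),
    (195, 9655, 3054), (196, 8791, 2910), (197, 7927, 2766), (198, 7063, 2622),
    (199, 6199, 2606), (200, 5335, 2596), (201, 4471, 2740), (202, 3607, 2884),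
    (203, 2743, 3028), (204, 1879, 3172), (205, 1015, 3324), (227, 9511, 2190),
    (228, 8647, 2046), (229, 7783, 1902), (230, 6919, 1758), (231, 6055, 1742),
    (232, 5191, 1732), (233, 4327, 1876), (234, 3463, 2020), (235, 2599, 2164),
    (236, 1735, 2308), (237, 871, 2460), (238, 7, 2334), (259, 9517, 1326), (260, 8653, 1182),
    (261, 7789, 1038), (262, 6925, 894), (263, 6061, 878), (266, 3469, 1156), (267, 2605, 1300),
    (268, 1741, 1444), (269, 877, 1596), (270, 13, 1470), (292, 8669, 318), (293, 7805, 174),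
    (294, 6941, 30), (295, 6077, 14), (299, 2621, 436), (300, 1757, 580), (301, 893, 732),
    (302, 29, 606), (303, 18, 462), (325, 7949, 167), (326, 7085, 23), (334, 173, 599),
    (335, 162, 455), (336, 145, 311), (368, 297, 290), (369, 1161, 146), (370, 2025, 2),
    (401, 1035, 1010), (402, 1899, 866)])
    (by decide +kernel)

theorem hasCommonUnfolding_1_2_13_2_3_7 :
    HasCommonUnfolding {(1, 2, 13), (2, 3, 7)} :=
  hasCommonUnfolding_of_isCommonNetCode (L := [
    (39, 6919, 2603), (43, 3463, 5192), (70, 7789, 1729), (71, 6925, 2593), (72, 6061, 3457),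
    (73, 5197, 4321), (74, 4333, 5185), (75, 3469, 6064), (102, 7805, 1873), (103, 6941, 2737),
    (104, 6077, 3601), (105, 5213, 4465), (106, 4349, 5329), (107, 3485, 6208),
    (133, 8813, 1153), (134, 7949, 2017), (135, 7085, 2881), (136, 6221, 3745),
    (137, 5357, 4609), (138, 4493, 5473), (164, 9807, 441), (165, 8943, 1305), (166, 8079, 2169),
    (167, 7215, 3033), (168, 6351, 3897), (169, 5487, 4761), (170, 4623, 5625),
    (171, 3759, 6357), (196, 9655, 465), (197, 8791, 1329), (198, 7927, 2193), (199, 7063, 3057),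
    (200, 6199, 3921), (201, 5335, 4785), (202, 4471, 5649), (203, 3607, 6381),
    (204, 2743, 6237), (205, 1879, 6093), (225, 10395, 295), (226, 11254, 308),
    (227, 10375, 332), (228, 9511, 339), (229, 8647, 1203), (230, 7783, 2067), (232, 6055, 3795),
    (233, 5191, 4659), (234, 4327, 5523), (236, 2599, 5382), (237, 1735, 5238), (238, 871, 5222),
    (259, 10381, 188), (260, 9517, 195), (261, 8653, 1059), (268, 2605, 4518), (269, 1741, 4374),
    (270, 877, 4358), (271, 13, 4334), (292, 9533, 51), (293, 8669, 915), (300, 2621, 3654),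
    (301, 1757, 3510), (302, 893, 3494), (303, 29, 3470), (323, 10541, 47), (324, 9677, 35),
    (331, 3629, 2934), (332, 2765, 2790), (333, 1901, 2646), (334, 1037, 2630),
    (354, 11395, 167), (355, 10671, 23), (364, 2895, 1926), (365, 2031, 1782), (366, 1167, 1766),
    (367, 303, 1742), (386, 10516, 146), (398, 1015, 902), (399, 151, 878), (400, 164, 868),
    (401, 171, 1012), (431, 7, 14), (432, 20, 4)])
    (by decide +kernel)

theorem hasCommonUnfolding_1_5_6_2_3_7 :
    HasCommonUnfolding {(1, 5, 6), (2, 3, 7)} :=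
  hasCommonUnfolding_of_isCommonNetCode (L := [
    (47, 2907, 3036), (79, 2763, 2172), (99, 449, 2600), (105, 871, 4791), (110, 1755, 1156),
    (111, 2619, 1308), (112, 3483, 1332), (130, 312, 3458), (131, 456, 3464), (136, 1741, 5631),
    (137, 877, 4767), (138, 13, 3903), (143, 2603, 444), (144, 3467, 468), (147, 4333, 2193),
    (162, 1176, 4322), (163, 1320, 4328), (169, 893, 4615), (170, 29, 3751), (171, 18, 2887),
    (172, 1, 2023), (174, 1729, 295), (175, 2593, 308), (176, 3457, 332), (177, 4321, 339),
    (178, 5200, 1203), (179, 4349, 2067), (193, 1896, 5330), (194, 2040, 5186),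
    (195, 2184, 5192), (201, 1037, 4471), (202, 173, 3607), (203, 162, 2743), (204, 145, 1879),
    (205, 1009, 1015), (206, 1873, 151), (207, 2737, 164), (208, 3601, 188), (209, 4465, 195),
    (210, 5344, 1059), (211, 4493, 1923), (212, 3629, 2787), (227, 3048, 6064), (235, 306, 2599),
    (236, 289, 1735), (237, 1153, 871), (238, 2017, 7), (239, 2881, 20), (240, 3745, 44),
    (244, 3773, 2643), (259, 3912, 6208), (268, 433, 1741), (269, 1297, 877), (270, 2161, 13),
    (290, 4632, 5473), (291, 4776, 6352), (292, 4920, 6376), (294, 4061, 6237),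
    (295, 3197, 6093), (296, 2333, 5221), (297, 1469, 4357), (298, 605, 3493), (299, 594, 2629),
    (300, 577, 1765), (301, 1441, 901), (302, 2305, 37), (324, 5779, 5652), (325, 5055, 5526),
    (326, 4191, 5382), (327, 3327, 5238), (332, 729, 1781), (333, 1593, 917), (334, 2457, 53),
    (357, 4903, 4662), (358, 4039, 4518), (359, 3175, 4374), (388, 5638, 3924),
    (389, 4759, 3798), (390, 3895, 3654), (391, 3031, 3510), (420, 5494, 3060),
    (421, 4615, 2934)])
    (by decide +kernel)

/-- The extremal case: the area is exactly 86, and `c = 21` is the largest side that occurs. -/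
theorem hasCommonUnfolding_1_1_21_1_3_10 :
    HasCommonUnfolding {(1, 1, 21), (1, 3, 10)} :=
  hasCommonUnfolding_of_isCommonNetCode (L := [
    (36, 15581, 6049), (37, 14717, 6913), (38, 13853, 7777), (68, 15711, 6193),
    (69, 14847, 7057), (70, 13983, 7921), (100, 15559, 6337), (101, 14695, 7201),
    (102, 13831, 8065), (131, 16429, 5625), (132, 15565, 6489), (133, 14701, 7353),
    (134, 13837, 8217), (135, 12973, 8949), (136, 12109, 8805), (137, 11245, 8661),
    (162, 17309, 4635), (163, 16445, 5499), (167, 12989, 8094), (168, 12125, 7950),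
    (169, 11261, 7806), (170, 10397, 7790), (194, 17439, 4491), (195, 16575, 5355),
    (199, 13119, 7230), (200, 12255, 7086), (201, 11391, 6942), (202, 10527, 6926),
    (226, 17287, 4347), (227, 16423, 5211), (231, 12967, 6366), (232, 12103, 6222),
    (233, 11239, 6078), (234, 10375, 6062), (257, 18165, 3467), (258, 17293, 4331),
    (266, 10381, 5198), (267, 9517, 5188), (268, 8653, 5332), (269, 7789, 5476),
    (299, 9533, 4324), (300, 8669, 4468), (301, 7805, 4612), (302, 6941, 4764),
    (331, 9663, 3460), (332, 8799, 3604), (333, 7935, 3748), (334, 7071, 3900),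
    (335, 6207, 3774), (336, 5343, 3630), (337, 4479, 3486), (363, 9511, 2596),
    (364, 8647, 2740), (365, 7783, 2884), (366, 6919, 3036), (367, 6055, 2910),
    (368, 5191, 2766), (369, 4327, 2622), (370, 3463, 2606), (398, 6925, 2172),
    (399, 6061, 2046), (400, 5197, 1902), (401, 4333, 1758), (402, 3469, 1742),
    (403, 2605, 1732), (404, 1741, 1876), (405, 877, 2020), (431, 6077, 1182), (432, 5213, 1038),
    (433, 4349, 894), (434, 3485, 878), (435, 2621, 868), (436, 1757, 1012), (437, 893, 1156),
    (466, 3615, 14), (467, 2751, 4), (468, 1887, 148), (469, 1023, 292), (499, 2599, 17),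
    (500, 1735, 161), (501, 871, 305), (502, 7, 441), (503, 20, 1305), (534, 13, 315),
    (566, 29, 171), (598, 159, 27)])
    (by decide +kernel)

/-! ## The boxes of surface area at most 86 -/

/-- Half the surface area of a box. -/
def halfArea (B : ℕ × ℕ × ℕ) : ℕ := B.1 * B.2.1 + B.1 * B.2.2 + B.2.1 * B.2.2

/-- The boxes of surface area at most 86. -/
def smallBoxes : List (ℕ × ℕ × ℕ) :=
  (List.range 4 ×ˢ List.range 6 ×ˢ List.range 22).filter fun B =>
    Nat.blt 0 B.1 && Nat.ble B.1 B.2.1 && Nat.ble B.2.1 B.2.2 && Nat.ble (halfArea B) 43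

theorem mem_smallBoxes {s : ℕ} (hs : s ≤ 86) {B : ℕ × ℕ × ℕ} (hB : B ∈ boxDims s) :
    B ∈ smallBoxes := by
  obtain ⟨a, b, c⟩ := B
  obtain ⟨ha, hab, hbc, harea⟩ := hB
  simp only at ha hab hbc harea
  -- With `ab + ac + bc ≤ 43`, the three bounds come from `3a² ≤ 43`, `b² + 2b ≤ 43` and `2c + 1 ≤
  -- 43`.
  have ha' : a < 4 := by nlinarith
  have hb' : b < 6 := by nlinarith
  have hc' : c < 22 := by nlinarith
  simp only [smallBoxes, halfArea, List.mem_filter, List.mem_product, List.mem_range,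
    Bool.and_eq_true, Nat.blt_eq, Nat.ble_eq]
  omega

/-- The pairs of distinct boxes of the same surface area, at most 86. -/
def equalAreaPairs : List ((ℕ × ℕ × ℕ) × (ℕ × ℕ × ℕ)) := [
  ((1, 1, 5), (1, 2, 3)), ((1, 1, 7), (1, 3, 3)), ((1, 1, 8), (1, 2, 5)),
  ((1, 1, 9), (1, 3, 4)), ((1, 2, 6), (2, 2, 4)), ((1, 1, 10), (2, 3, 3)),
  ((1, 1, 11), (1, 2, 7)), ((1, 1, 11), (1, 3, 5)), ((1, 2, 7), (1, 3, 5)),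
  ((1, 4, 4), (2, 2, 5)), ((1, 2, 8), (2, 3, 4)), ((1, 1, 13), (1, 3, 6)),
  ((1, 1, 13), (3, 3, 3)), ((1, 3, 6), (3, 3, 3)), ((1, 1, 14), (1, 2, 9)),
  ((1, 1, 14), (1, 4, 5)), ((1, 2, 9), (1, 4, 5)), ((1, 1, 15), (1, 3, 7)),
  ((1, 1, 15), (2, 3, 5)), ((1, 3, 7), (2, 3, 5)), ((1, 2, 10), (2, 2, 7)),
  ((1, 2, 10), (2, 4, 4)), ((2, 2, 7), (2, 4, 4)), ((1, 1, 16), (3, 3, 4)),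
  ((1, 1, 17), (1, 2, 11)), ((1, 1, 17), (1, 3, 8)), ((1, 1, 17), (1, 5, 5)),
  ((1, 2, 11), (1, 3, 8)), ((1, 2, 11), (1, 5, 5)), ((1, 3, 8), (1, 5, 5)),
  ((2, 2, 8), (2, 3, 6)), ((1, 2, 12), (2, 4, 5)), ((1, 1, 19), (1, 3, 9)),
  ((1, 1, 19), (1, 4, 7)), ((1, 1, 19), (3, 3, 5)), ((1, 3, 9), (1, 4, 7)),
  ((1, 3, 9), (3, 3, 5)), ((1, 4, 7), (3, 3, 5)), ((2, 2, 9), (3, 4, 4)),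
  ((1, 1, 20), (1, 2, 13)), ((1, 1, 20), (1, 5, 6)), ((1, 1, 20), (2, 3, 7)),
  ((1, 2, 13), (1, 5, 6)), ((1, 2, 13), (2, 3, 7)), ((1, 5, 6), (2, 3, 7)),
  ((1, 1, 21), (1, 3, 10))]

/-- This is the completeness of the table, by exhaustion over all pairs of small boxes. Each
unordered pair is listed in one order only, hence the disjunction. -/
theorem mem_equalAreaPairs : ∀ B₁ ∈ smallBoxes, ∀ B₂ ∈ smallBoxes,
    halfArea B₁ = halfArea B₂ → B₁ ≠ B₂ →
      (B₁, B₂) ∈ equalAreaPairs ∨ (B₂, B₁) ∈ equalAreaPairs := by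
  decide +kernel

theorem hasCommonUnfolding_of_mem_equalAreaPairs :
    ∀ p ∈ equalAreaPairs, HasCommonUnfolding {p.1, p.2} := by
  simp only [equalAreaPairs, List.forall_mem_cons]
  exact ⟨
    hasCommonUnfolding_1_1_5_1_2_3, hasCommonUnfolding_1_1_7_1_3_3,
    hasCommonUnfolding_1_1_8_1_2_5, hasCommonUnfolding_1_1_9_1_3_4,
    hasCommonUnfolding_1_2_6_2_2_4, hasCommonUnfolding_1_1_10_2_3_3,
    hasCommonUnfolding_1_1_11_1_2_7, hasCommonUnfolding_1_1_11_1_3_5,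
    hasCommonUnfolding_1_2_7_1_3_5, hasCommonUnfolding_1_4_4_2_2_5,
    hasCommonUnfolding_1_2_8_2_3_4, hasCommonUnfolding_1_1_13_1_3_6,
    hasCommonUnfolding_1_1_13_3_3_3, hasCommonUnfolding_1_3_6_3_3_3,
    hasCommonUnfolding_1_1_14_1_2_9, hasCommonUnfolding_1_1_14_1_4_5,
    hasCommonUnfolding_1_2_9_1_4_5, hasCommonUnfolding_1_1_15_1_3_7,
    hasCommonUnfolding_1_1_15_2_3_5, hasCommonUnfolding_1_3_7_2_3_5,
    hasCommonUnfolding_1_2_10_2_2_7, hasCommonUnfolding_1_2_10_2_4_4,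
    hasCommonUnfolding_2_2_7_2_4_4, hasCommonUnfolding_1_1_16_3_3_4,
    hasCommonUnfolding_1_1_17_1_2_11, hasCommonUnfolding_1_1_17_1_3_8,
    hasCommonUnfolding_1_1_17_1_5_5, hasCommonUnfolding_1_2_11_1_3_8,
    hasCommonUnfolding_1_2_11_1_5_5, hasCommonUnfolding_1_3_8_1_5_5,
    hasCommonUnfolding_2_2_8_2_3_6, hasCommonUnfolding_1_2_12_2_4_5,
    hasCommonUnfolding_1_1_19_1_3_9, hasCommonUnfolding_1_1_19_1_4_7,
    hasCommonUnfolding_1_1_19_3_3_5, hasCommonUnfolding_1_3_9_1_4_7,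
    hasCommonUnfolding_1_3_9_3_3_5, hasCommonUnfolding_1_4_7_3_3_5,
    hasCommonUnfolding_2_2_9_3_4_4, hasCommonUnfolding_1_1_20_1_2_13,
    hasCommonUnfolding_1_1_20_1_5_6, hasCommonUnfolding_1_1_20_2_3_7,
    hasCommonUnfolding_1_2_13_1_5_6, hasCommonUnfolding_1_2_13_2_3_7,
    hasCommonUnfolding_1_5_6_2_3_7, hasCommonUnfolding_1_1_21_1_3_10,
    by simp⟩

theorem hasCommonUnfolding_of_le {s : ℕ} (hs : s ≤ 86) {B₁ B₂ : ℕ × ℕ × ℕ}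
    (h₁ : B₁ ∈ boxDims s) (h₂ : B₂ ∈ boxDims s) (hne : B₁ ≠ B₂) :
    HasCommonUnfolding {B₁, B₂} := by
  have harea : halfArea B₁ = halfArea B₂ :=
    Nat.eq_of_mul_eq_mul_left two_pos (h₁.2.2.2.trans h₂.2.2.2.symm)
  rcases mem_equalAreaPairs _ (mem_smallBoxes hs h₁) _ (mem_smallBoxes hs h₂) harea hne with h | h
  · exact hasCommonUnfolding_of_mem_equalAreaPairs _ h
  · rw [Set.pair_comm]
    exact hasCommonUnfolding_of_mem_equalAreaPairs _ h

theorem mainTheorem2 :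
    (∀ s : ℕ, s ≤ 86 → ∀ B₁ ∈ boxDims s, ∀ B₂ ∈ boxDims s, B₁ ≠ B₂ →
      HasCommonUnfolding {B₁, B₂}) ∧
    86 < unfoldingDelta 2 := by
  refine ⟨fun s hs B₁ h₁ B₂ h₂ hne => hasCommonUnfolding_of_le hs h₁ h₂ hne, ?_⟩
  -- A strict bound on an infimum is obtained through the weak bound 87 on every member.
  have hlt : (86 : ℕ∞) < (87 : ℕ) := by norm_num
  refine hlt.trans_le (le_iInf₂ fun s hs => ?_)
  obtain ⟨-, S, hS, hcard, hno⟩ := hs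
  rw [Nat.cast_le]
  by_contra hs
  obtain ⟨B₁, B₂, hne, rfl⟩ := Set.encard_eq_two.1 hcard
  exact hno (hasCommonUnfolding_of_le (by omega) (hS (by simp)) (hS (by simp)) hne)
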